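/- **Setting.** Let $d$ be a prime and $\omega=e^{2\pi i/d}$. All Hilbert spaces are finite-dimensional. A $d$-outcome measurement is a family $\{F_a\}_{a=0}^{d-1}$ of positive semidefinite operators with $\sum_a F_a=\mathbb 1$; write $A^{(n)}=\sum_a\omega^{an}F_a$. Alice and Bob each have $d$ measurements, $\{F^j_a\}$ and $\{G^k_b\}$ ($j,k,a,b\in\{0,\dots,d-1\}$), with transforms $A_j^{(n)}$ and $B_k^{(n)}$. Complex numbers $\lambda_0,\dots,\lambda_{d-1}$ are called admissible phases if $|\lambda_n|=1$ for all $n$, $\lambda_0=1$, and $\lambda_n=\lambda_{d-n}^*$ for $1\le n\le d-1$. Put $$W_d=\frac1{d^3}\sum_{n=0}^{d-1}\lambda_n\sum_{j,k=0}^{d-1}\omega^{njk}A_j^{(n)}\otimes B_k^{(n)},\qquad c_{abjk}=\frac1{d^3}\sum_{n=0}^{d-1}\lambda_n\,\omega^{n(a+b+jk)}.$$ Let $\beta_Q$ be the supremum of $\sum_{abjk}c_{abjk}P(ab|jk)$ over all quantum correlations $P(ab|jk)=\mathrm{tr}[(F_a^j\otimes G_b^k)\rho]$, where $\rho$ is a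 density matrix on a tensor product of two finite-dimensional spaces and $\{F_a^j\},\{G_b^k\}$ are measurements as above. **Upper bound.** For all admissible phases the coefficients $c_{abjk}$ are real, and for all measurements of Alice and Bob $$W_d=\sum_{abjk}c_{abjk}\,F^j_a\otimes G^k_b\;\le\;\Big(\frac1d+\frac{d-1}{d\sqrt d}\Big)\mathbb 1 .$$ **Attainment.** Let $d$ be odd. Put $\lambda_0=1$ and, for $1\le n\le d-1$, $$\lambda_n=\Big[\varepsilon_d\Big(\frac nd\Big)\Big]^{-1}e^{-2\pi i\,g(n,d)/(48d)},$$ where $\big(\frac nd\big)$ is the Legendre symbol, $\varepsilon_d=1$ if $d\equiv1$ and $\varepsilon_d=i$ if $d\equiv3 \pmod 4$, and $$g(n,d)=\begin{cases}n[n^2-d(d+6)+3]&n\text{ even},\ (n+d+1)/2\text{ even},\\ n[n^2-d(d-6)+3]&n\text{ even},\ (n+d+1)/2\text{ odd},\\ n(n^2+3)+2d^2(-5n+3)&n\equiv1\ (\mathrm{mod}\ 4),\\ n(n^2+3)+2d^2(n+3)&n\equiv3\ (\mathrm{mod}\ 4).\end{cases}$$ These phases are admissible. Let $X=\sum_j|j+1\rangle\langle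 j|$ (with $|d\rangle=|0\rangle$), $Z=\sum_j\omega^j|j\rangle\langle j|$, $B_k=\omega^{k(k+1)}XZ^k$, $C_j^{(1)}=\frac{\lambda_1}{\sqrt d}\sum_k\omega^{jk}B_k$, and $A_j=(C_j^{(1)})^*$ (entrywise complex conjugate). There are rank-one projective $d$-outcome measurements on $\mathbb C^d$ with transforms $A_j^{(n)}=A_j^n$ for Alice and $B_k^{(n)}=B_k^n$ for Bob, for all $n\ge 0$. The measured bases of Alice are pairwise mutually unbiased, and so are those of Bob. For these measurements the unit vector $|\Phi_d\rangle=\frac1{\sqrt d}\sum_j|j\rangle|j\rangle$ satisfies $$\langle\Phi_d|W_d|\Phi_d\rangle=\frac1d+\frac{d-1}{d\sqrt d}.$$ Consequently the supremum $\beta_Q$ is attained and $\beta_Q=\frac1d+\frac{d-1}{d\sqrt d}$. -/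

import Mathlib

open scoped Kronecker ComplexOrder MatrixOrder

noncomputable section

namespace BuhrmanMassar

/-- The primitive root of unity `ω = exp (2πi / d)`. -/
def omega (d : ℕ) : ℂ := Complex.exp (2 * Real.pi * Complex.I / d)

/-! Measurements -/

/-- A measurement with `d` outcomes on the finite-dimensional Hilbert space `ℂ^ι`. -/
structure Measurement (d : ℕ) (ι : Type*) [Fintype ι] [DecidableEq ι] where
  /-- the measurement operators -/
  F : Fin d → Matrix ι ι ℂ
  posSemidef : ∀ a, (F a).PosSemidef
  sum_eq_one : ∑ a, F a = 1

namespace Measurement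

variable {d : ℕ} {ι : Type*} [Fintype ι] [DecidableEq ι]

/-- The Fourier transform `A^{(n)} = ∑_a ω^{a n} F_a` of a measurement. -/
def fourier (M : Measurement d ι) (n : ℕ) : Matrix ι ι ℂ :=
  ∑ a : Fin d, omega d ^ ((a : ℕ) * n) • M.F a

/-- The measurement operators are mutually orthogonal projectors. -/
def IsProjective (M : Measurement d ι) : Prop :=
  ∀ a b, M.F a * M.F b = if a = b then M.F a else 0

/-- A measurement by rank-one orthogonal projectors, i.e. in an orthonormal basis. -/
def IsRankOneProjective (M : Measurement d ι) : Prop :=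
  M.IsProjective ∧ ∀ a, (M.F a).rank = 1

/-- Unit vectors fixed by an effect of `M` and by an effect of `N` respectively have squared
overlap `1 / dim`.  For rank-one projective measurements this says that the two measured
orthonormal bases are mutually unbiased. -/
def MutuallyUnbiased (M N : Measurement d ι) : Prop :=
  ∀ (a b : Fin d) (u v : ι → ℂ), star u ⬝ᵥ u = 1 → star v ⬝ᵥ v = 1 →
    Matrix.mulVec (M.F a) u = u → Matrix.mulVec (N.F b) v = v →
      ‖star u ⬝ᵥ v‖ ^ 2 = 1 / (Fintype.card ι : ℝ)

end Measurement

/-! Quantum correlations -/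

/-- A density matrix. -/
def IsDensityMatrix {ι : Type*} [Fintype ι] (ρ : Matrix ι ι ℂ) : Prop :=
  ρ.PosSemidef ∧ ρ.trace = 1

/-- The correlations `P a b j k = P(ab|jk)` obtained from local measurements on a bipartite
quantum state of arbitrary finite local dimensions, with `d` settings and `d` outcomes
per party. -/
def quantumSet (d : ℕ) : Set (Fin d → Fin d → Fin d → Fin d → ℝ) :=
  {P | ∃ (m n : ℕ) (ρ : Matrix (Fin m × Fin n) (Fin m × Fin n) ℂ)
      (MA : Fin d → Measurement d (Fin m)) (MB : Fin d → Measurement d (Fin n)),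
      IsDensityMatrix ρ ∧
      ∀ a b j k, (P a b j k : ℂ) = Matrix.trace (((MA j).F a ⊗ₖ (MB k).F b) * ρ)}

/-! The modified Buhrman--Massar functional -/

/-- Admissible phases: `|λ_n| = 1`, `λ_0 = 1` and `λ_n = conj λ_{d-n}`; only the values
`λ_0, …, λ_{d-1}` matter. -/
def AdmissiblePhases (d : ℕ) (lam : ℕ → ℂ) : Prop :=
  (∀ n < d, ‖lam n‖ = 1) ∧ lam 0 = 1 ∧
    ∀ n, 1 ≤ n → n < d → lam n = star (lam (d - n))

/-- The Bell coefficients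
`c_{abjk} = d⁻³ ∑_n λ_n ω^{n (a + b + j k)}` (real for admissible phases). For `λ_n = 1` they
are `1 / d²` if `a + b + j k ≡ 0 mod d` and `0` otherwise. -/
def bellCoeff (d : ℕ) (lam : ℕ → ℂ) (a b j k : Fin d) : ℂ :=
  1 / (d : ℂ) ^ 3 *
    ∑ n ∈ Finset.range d, lam n * omega d ^ (n * ((a : ℕ) + (b : ℕ) + (j : ℕ) * (k : ℕ)))

/-- The Bell functional `β(P) = ∑_{abjk} c_{abjk} P(ab|jk)`. -/
def bellFunctional (d : ℕ) (lam : ℕ → ℂ) (P : Fin d → Fin d → Fin d → Fin d → ℝ) : ℝ :=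
  ∑ a, ∑ b, ∑ j, ∑ k, (bellCoeff d lam a b j k).re * P a b j k

/-- The quantum value `β_Q`, the supremum of the functional over the quantum set. -/
def quantumValue (d : ℕ) (lam : ℕ → ℂ) : ℝ :=
  sSup (bellFunctional d lam '' quantumSet d)

/-- The Bell operator
`W_d = d⁻³ ∑_n λ_n ∑_{j,k} ω^{n j k} A_j^{(n)} ⊗ B_k^{(n)}`. -/
def bellOperator (d : ℕ) (lam : ℕ → ℂ) {ι κ : Type*} [Fintype ι] [DecidableEq ι]
    [Fintype κ] [DecidableEq κ] (MA : Fin d → Measurement d ι)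
    (MB : Fin d → Measurement d κ) : Matrix (ι × κ) (ι × κ) ℂ :=
  (1 / (d : ℂ) ^ 3) • ∑ n ∈ Finset.range d, lam n •
    ∑ j : Fin d, ∑ k : Fin d,
      omega d ^ (n * (j : ℕ) * (k : ℕ)) • ((MA j).fourier n ⊗ₖ (MB k).fourier n)

/-- The number `1/d + (d-1)/(d√d)`. -/
def optimalValue (d : ℕ) : ℝ := 1 / d + ((d : ℝ) - 1) / (d * √(d : ℝ))

/-! The phases for odd prime `d` -/

/-- `ε_d`, equal to `1` if `d ≡ 1 mod 4` and to `i` if `d ≡ 3 mod 4`. -/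
def epsilon (d : ℕ) : ℂ := if d % 4 = 1 then 1 else Complex.I

/-- The integer `g(n, d)`, for odd `d`. -/
def g (n d : ℕ) : ℤ :=
  if n % 2 = 0 then
    if (n + d + 1) / 2 % 2 = 0 then
      (n : ℤ) * ((n : ℤ) ^ 2 - (d : ℤ) * ((d : ℤ) + 6) + 3)
    else
      (n : ℤ) * ((n : ℤ) ^ 2 - (d : ℤ) * ((d : ℤ) - 6) + 3)
  else
    if n % 4 = 1 then
      (n : ℤ) * ((n : ℤ) ^ 2 + 3) + 2 * (d : ℤ) ^ 2 * (-5 * (n : ℤ) + 3)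
    else
      (n : ℤ) * ((n : ℤ) ^ 2 + 3) + 2 * (d : ℤ) ^ 2 * ((n : ℤ) + 3)

/-- The phases `λ_0 = 1` and `λ_n = [ε_d (n/d)]⁻¹ ω^{-g(n,d)/48}` for `1 ≤ n ≤ d - 1`, where
`(n/d)` is the Legendre symbol and `ω^x = exp (2πi x / d)` for real `x`. -/
def phase (d : ℕ) [Fact d.Prime] (n : ℕ) : ℂ :=
  if n = 0 then 1
  else (epsilon d * (legendreSym d (n : ℤ) : ℂ))⁻¹ *
    Complex.exp (2 * Real.pi * Complex.I / d * (-(g n d : ℂ) / 48))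

/-! The optimal realisation -/

/-- The maximally entangled vector `Φ = d^{-1/2} ∑_j |j⟩|j⟩`. -/
def maxEntangled (d : ℕ) : Fin d × Fin d → ℂ :=
  fun p => if p.1 = p.2 then ((1 / √(d : ℝ) : ℝ) : ℂ) else 0

/-- The shift operator `X = ∑_j |j+1⟩⟨j|`, with `|d⟩ = |0⟩`. -/
def shiftX (d : ℕ) : Matrix (Fin d) (Fin d) ℂ :=
  Matrix.of fun r c => if (r : ℕ) = ((c : ℕ) + 1) % d then 1 else 0

/-- The clock operator `Z = ∑_j ω^j |j⟩⟨j|`. -/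
def clockZ (d : ℕ) : Matrix (Fin d) (Fin d) ℂ :=
  Matrix.diagonal fun j => omega d ^ (j : ℕ)

/-- Bob's observables `B_k = ω^{k(k+1)} X Z^k`. -/
def bobObs (d : ℕ) (k : Fin d) : Matrix (Fin d) (Fin d) ℂ :=
  omega d ^ ((k : ℕ) * ((k : ℕ) + 1)) • (shiftX d * clockZ d ^ (k : ℕ))

/-- The operators `C_j^{(n)} = (λ_n / √d) ∑_k ω^{n j k} B_k^{(n)}` built from Bob's
observables, for which `B_k^{(n)} = B_k^n`. -/
def opC (d : ℕ) (lam : ℕ → ℂ) (j : Fin d) (n : ℕ) : Matrix (Fin d) (Fin d) ℂ :=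
  (lam n / ((√(d : ℝ) : ℝ) : ℂ)) •
    ∑ k : Fin d, omega d ^ (n * (j : ℕ) * (k : ℕ)) • bobObs d k ^ n

/-- Alice's observables `A_j = (C_j^{(1)})^*`, the entrywise complex conjugate. -/
def aliceObs (d : ℕ) (lam : ℕ → ℂ) (j : Fin d) : Matrix (Fin d) (Fin d) ℂ :=
  (opC d lam j 1).map star

end BuhrmanMassar

end

open BuhrmanMassar

/-!
Upper bound. Let `C_j^{(n)} = (λ_n / √d) ∑_k ω^{njk} B_k^{(n)}` (`dualOp`). Separating `n = 0`
gives `W_d = 1/d + (√d / d³) T` with `T = ∑_{n ≥ 1} ∑_j A_j^{(n)} ⊗ C_j^{(n)}`. Transforms of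
measurements are contractions, and `∑_j C_jᴴ C_j = ∑_k B_kᴴ B_k` by orthogonality of characters
(`sum_conjTranspose_dualOp_mul`), so expanding the squares
`(A_jᴴ ⊗ 1 - 1 ⊗ C_j)ᴴ (A_jᴴ ⊗ 1 - 1 ⊗ C_j)` shows `T + Tᴴ ≤ 2 d (d - 1)` (`posSemidef_sub_sum_kronecker_dualOp`). As the Bell
coefficients are real, `W_d` is Hermitian and the bound follows.

Attainment. All the operators involved are weighted shifts `∑_c f(c) |c + n⟩⟨c|` with indices in
`ZMod d`. Completing the square in the sum over `k` turns `C_j^{(n)}` into a quadratic Gauss sum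
times a weighted shift with quadratic phases (`opC_phase_eq_weightedShift`); the Gauss sum is
`(n/d) ε_d √d` (`sum_stdAddChar_mul_sq`), which the first factor of `λ_n` cancels. The four cases
of `g(n, d)` agree modulo `48 d` with the polynomial `(1 - d²) n (n² + 3)`
(`dvd_g_sub_cubicExponent`), whose first differences are exactly what makes `C_j^{(n)}` the `n`-th
power of `C_j^{(1)}` (`opC_one_pow`), with `d`-th power `1`. So `A_j` and `B_k` generate unitary
representations of `ZMod d`; their isotypic projectors are the measurements. They have rank one
since `tr A_j^n = 0` for `d ∤ n`, and the bases are mutually unbiased since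
`tr (A_j^n A_{j'}^m) = 0` (`j ≠ j'`) unless `d` divides both `n` and `m`. Finally `⟨Φ| conj U ⊗ U |Φ⟩ = 1` for every unitary `U`, so
each of the `d (d - 1)` terms of `T` has expectation `1`.

The sign of the Gauss sum comes from Gauss's evaluation of the alternating sum of `q`-binomial
coefficients (`qAltSum_two_mul`) at `q = ω⁻²`, which writes the Gauss sum as a product of sines
whose signs can be counted; its modulus is given by `gaussSum_sq`.
-/

namespace BuhrmanMassar

open scoped Matrix

variable {d : ℕ}

/-- The additive character `x ↦ ω^x` of `ZMod d`. -/
local notation "ψ" => ZMod.stdAddChar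

/-! ### The sign of the quadratic Gauss sum -/

section QBinomial

variable {K : Type*} [Field K]

/-- The Gaussian binomial coefficient `[m choose j]_q`, as a quotient of products. The division
is meaningful as long as `q ^ i ≠ 1` for `1 ≤ i ≤ j`; the value at `j = m + 1` is `0`. -/
def qBinom (q : K) (m j : ℕ) : K :=
  (∏ i ∈ Finset.range j, (1 - q ^ (m - i))) / ∏ i ∈ Finset.range j, (1 - q ^ (i + 1))

lemma qBinom_zero_right (q : K) (m : ℕ) : qBinom q m 0 = 1 := by simp [qBinom]

lemma qBinom_self_succ (q : K) (m : ℕ) : qBinom q m (m + 1) = 0 := by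
  simp [qBinom, Finset.prod_range_succ]

lemma qBinom_succ_right (q : K) (m j : ℕ) :
    qBinom q m (j + 1) = qBinom q m j * ((1 - q ^ (m - j)) / (1 - q ^ (j + 1))) := by
  simp only [qBinom, Finset.prod_range_succ]
  rw [mul_div_mul_comm]

lemma qBinom_succ_succ (q : K) (m j : ℕ) :
    qBinom q (m + 1) (j + 1) = qBinom q m j * ((1 - q ^ (m + 1)) / (1 - q ^ (j + 1))) := by
  simp only [qBinom]
  rw [Finset.prod_range_succ', Finset.prod_range_succ (fun i => 1 - q ^ (i + 1)), mul_div_mul_comm]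
  simp

/-- One of the two `q`-Pascal rules. -/
lemma qBinom_pascal {q : K} {m j : ℕ} (hj : j ≤ m) (hq : q ^ (j + 1) ≠ 1) :
    qBinom q (m + 1) (j + 1) = qBinom q m j + q ^ (j + 1) * qBinom q m (j + 1) := by
  have h : (1 - q ^ (j + 1)) ≠ 0 := sub_ne_zero.2 hq.symm
  have e : q ^ (m + 1) = q ^ (j + 1) * q ^ (m - j) := by rw [← pow_add]; congr 1; lia
  rw [qBinom_succ_succ, qBinom_succ_right, e]
  field_simp
  ring

/-- The other `q`-Pascal rule. -/
lemma qBinom_pascal' {q : K} {m j : ℕ} (hj : j ≤ m) (hq : q ^ (j + 1) ≠ 1) :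
    qBinom q (m + 1) (j + 1) = q ^ (m - j) * qBinom q m j + qBinom q m (j + 1) := by
  have h : (1 - q ^ (j + 1)) ≠ 0 := sub_ne_zero.2 hq.symm
  have e : q ^ (m + 1) = q ^ (j + 1) * q ^ (m - j) := by rw [← pow_add]; congr 1; lia
  rw [qBinom_succ_succ, qBinom_succ_right, e]
  field_simp
  ring

/-- The alternating sum of the Gaussian binomial coefficients `[m choose j]_q`. -/
def qAltSum (q : K) (m : ℕ) : K := ∑ j ∈ Finset.range (m + 1), (-1) ^ j * qBinom q m j

/-- The alternating sum of `q ^ (m - j) * [m choose j]_q`. -/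
def qAltSumTwist (q : K) (m : ℕ) : K :=
  ∑ j ∈ Finset.range (m + 1), (-1) ^ j * (q ^ (m - j) * qBinom q m j)

lemma qAltSum_eq_shift (q : K) (m : ℕ) :
    qAltSum q m = ∑ j ∈ Finset.range (m + 1), (-1) ^ (j + 1) * qBinom q m (j + 1) + 1 := by
  have h := Finset.sum_range_succ' (fun j => (-1) ^ j * qBinom q m j) (m + 1)
  rw [Finset.sum_range_succ, qBinom_self_succ] at h
  simpa [qAltSum, qBinom_zero_right] using h

lemma qAltSum_succ {q : K} {m : ℕ} (hq : ∀ i, 1 ≤ i → i ≤ m + 1 → q ^ i ≠ 1) :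
    qAltSum q (m + 1) = qAltSum q m - qAltSumTwist q m := by
  rw [qAltSum_eq_shift q m, qAltSum, Finset.sum_range_succ', qAltSumTwist]
  simp only [pow_zero, qBinom_zero_right, mul_one]
  rw [add_sub_right_comm, ← Finset.sum_sub_distrib]
  congr 1
  refine Finset.sum_congr rfl fun j hj => ?_
  have hj := Finset.mem_range.1 hj
  rw [qBinom_pascal' (by lia) (hq _ (by lia) (by lia))]
  ring

lemma qAltSumTwist_succ {q : K} {m : ℕ} (hq : ∀ i, 1 ≤ i → i ≤ m + 1 → q ^ i ≠ 1) :
    qAltSumTwist q (m + 1) = q ^ (m + 1) * qAltSum q m - qAltSumTwist q m := by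
  rw [qAltSum_eq_shift q m, qAltSumTwist, Finset.sum_range_succ', qAltSumTwist]
  simp only [pow_zero, qBinom_zero_right, mul_one, mul_add, one_mul, Nat.sub_zero]
  rw [add_sub_right_comm, Finset.mul_sum, ← Finset.sum_sub_distrib]
  congr 1
  refine Finset.sum_congr rfl fun j hj => ?_
  have hj := Finset.mem_range.1 hj
  have e : q ^ (m + 1) = q ^ (j + 1) * q ^ (m - j) := by rw [← pow_add]; congr 1; lia
  rw [qBinom_pascal (by lia) (hq _ (by lia) (by lia)), e, Nat.add_sub_add_right]
  ring

/-- Gauss's product formula `∑ⱼ (-1)ʲ [2N choose j]_q = (1 - q)(1 - q³)⋯(1 - q^(2N-1))`. -/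
lemma qAltSum_two_mul {q : K} {N : ℕ} (hq : ∀ i, 1 ≤ i → i ≤ 2 * N → q ^ i ≠ 1) :
    qAltSum q (2 * N) = ∏ l ∈ Finset.range N, (1 - q ^ (2 * l + 1)) := by
  induction N with
  | zero => simp [qAltSum, qBinom_zero_right]
  | succ N ih =>
    rw [Finset.prod_range_succ, ← ih fun i h1 h2 => hq i h1 (by lia)]
    have h1 : 2 * (N + 1) = 2 * N + 1 + 1 := by ring
    rw [h1, qAltSum_succ fun i h1 h2 => hq i h1 (by lia),
      qAltSum_succ fun i h1 h2 => hq i h1 (by lia),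
      qAltSumTwist_succ fun i h1 h2 => hq i h1 (by lia)]
    ring

/-- At a `p`-th root of unity, `[p - 1 choose j]_q = (-1)ʲ q^(-j(j+1)/2)`; here `m = p - 1`. -/
lemma qBinom_mul_pow_choose {q : K} {m j : ℕ} (hq : ∀ i, 1 ≤ i → i ≤ m → q ^ i ≠ 1)
    (hq1 : q ^ (m + 1) = 1) (hj : j ≤ m) :
    qBinom q m j * q ^ (j * (j + 1) / 2) = (-1) ^ j := by
  induction j with
  | zero => simp [qBinom_zero_right]
  | succ j ih =>
    have h : (1 - q ^ (j + 1)) ≠ 0 := sub_ne_zero.2 (hq _ (by lia) hj).symm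
    have e : q ^ (j + 1) * q ^ (m - j) = 1 := by rw [← pow_add, ← hq1]; congr 1; lia
    have e2 : (j + 1) * (j + 1 + 1) / 2 = j * (j + 1) / 2 + (j + 1) := by
      rw [show (j + 1) * (j + 1 + 1) = j * (j + 1) + (j + 1) * 2 by ring,
        Nat.add_mul_div_right _ _ (by norm_num)]
    rw [qBinom_succ_right, e2, pow_add, pow_succ (-1 : K), ← ih (by lia)]
    have key : (1 - q ^ (m - j)) / (1 - q ^ (j + 1)) * q ^ (j + 1) = -1 := by
      rw [div_mul_eq_mul_div, div_eq_iff h]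
      linear_combination -e
    linear_combination (qBinom q m j * q ^ (j * (j + 1) / 2)) * key

end QBinomial

lemma stdAddChar_natCast_pow [NeZero d] (x : ZMod d) (n : ℕ) :
    (ψ x : ℂ) ^ n = ψ ((n : ZMod d) * x) := by
  rw [← nsmul_eq_mul, AddChar.map_nsmul_eq_pow]

lemma stdAddChar_sum [NeZero d] {ι : Type*} (s : Finset ι) (f : ι → ZMod d) :
    (ψ (∑ i ∈ s, f i) : ℂ) = ∏ i ∈ s, ψ (f i) := by
  induction s using Finset.cons_induction with
  | empty => simp
  | cons a s ha ih => rw [Finset.sum_cons, Finset.prod_cons, AddChar.map_add_eq_mul, ih]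

lemma stdAddChar_eq_one_iff [NeZero d] (x : ZMod d) : (ψ x : ℂ) = 1 ↔ x = 0 := by
  rw [← AddChar.map_zero_eq_one (ZMod.stdAddChar (N := d)), ZMod.injective_stdAddChar.eq_iff]

/-- A sum over `ZMod d` written with the representatives `0, …, d - 1`. -/
lemma sum_range_natCast [NeZero d] {M : Type*} [AddCommMonoid M] (f : ZMod d → M) :
    ∑ j ∈ Finset.range d, f (j : ZMod d) = ∑ x, f x := by
  refine Finset.sum_bij' (fun j _ => (j : ZMod d)) (fun x _ => x.val) (by simp)
    (fun x _ => by simpa using ZMod.val_lt x) (fun j hj => ?_) (by simp) (by simp)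
  exact ZMod.val_cast_of_lt (by simpa using hj)

lemma stdAddChar_sub_stdAddChar_neg [NeZero d] (k : ℕ) :
    (ψ (k : ZMod d) : ℂ) - ψ (-(k : ZMod d)) =
      2 * Complex.I * (Real.sin (2 * Real.pi * k / d) : ℝ) := by
  have h1 := ZMod.stdAddChar_coe (N := d) k
  have h2 := ZMod.stdAddChar_coe (N := d) (-k)
  push_cast at h1 h2
  rw [h1, h2, Complex.ofReal_sin, Complex.sin]
  push_cast
  have e1 : 2 * (Real.pi : ℂ) * Complex.I * k / d = 2 * Real.pi * k / d * Complex.I := by ring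
  have e2 : 2 * (Real.pi : ℂ) * Complex.I * -k / d = -(2 * Real.pi * k / d) * Complex.I := by ring
  rw [e1, e2]
  linear_combination (-(Complex.exp (-(2 * Real.pi * k / d) * Complex.I) -
    Complex.exp (2 * Real.pi * k / d * Complex.I))) * Complex.I_sq

lemma ne_zero_two [Fact d.Prime] (hd : d ≠ 2) : (2 : ZMod d) ≠ 0 := by
  intro h
  have : d ∣ 2 := (ZMod.natCast_eq_zero_iff 2 d).1 (by exact_mod_cast h)
  exact hd ((Nat.prime_dvd_prime_iff_eq Fact.out Nat.prime_two).1 this)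

lemma sum_range_odd (N : ℕ) : ∑ l ∈ Finset.range N, (2 * (l : ZMod d) + 1) = (N : ZMod d) ^ 2 := by
  induction N with
  | zero => simp
  | succ N ih => rw [Finset.sum_range_succ, ih]; push_cast; ring

/-- The quadratic Gauss sum as a product of sines, for `d = 2 N + 1`. -/
lemma sum_stdAddChar_sq_eq_prod [Fact d.Prime] {N : ℕ} (hN : d = 2 * N + 1) :
    ∑ x : ZMod d, (ψ (x ^ 2) : ℂ) =
      ∏ l ∈ Finset.range N,
        (2 * Complex.I * (Real.sin (2 * Real.pi * (2 * l + 1 : ℕ) / d) : ℝ)) := by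
  have h2 : (2 : ZMod d) ≠ 0 := ne_zero_two (by lia)
  have hN2 : (2 : ZMod d) * N = -1 := by
    have : ((2 * N + 1 : ℕ) : ZMod d) = 0 := by rw [← hN]; simp
    push_cast at this
    linear_combination this
  -- Gauss's product formula is used at `q = ω⁻²`.
  set q : ℂ := ψ (-2 : ZMod d) with hqdef
  have hpow (i : ℕ) : q ^ i = ψ (-(2 * (i : ZMod d))) := by
    rw [hqdef, stdAddChar_natCast_pow]; congr 1; ring
  have hq : ∀ i, 1 ≤ i → i ≤ 2 * N → q ^ i ≠ 1 := by
    intro i h1 hi h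
    rw [hpow, stdAddChar_eq_one_iff, neg_eq_zero, mul_eq_zero, or_iff_right h2,
      ZMod.natCast_eq_zero_iff] at h
    exact absurd (Nat.le_of_dvd (by lia) h) (by lia)
  have hq1 : q ^ (2 * N + 1) = 1 := by
    rw [hpow, ← hN]; simp
  have hsum : qAltSum q (2 * N) = ∑ x : ZMod d, (ψ (x * (x + 1)) : ℂ) := by
    rw [← sum_range_natCast, qAltSum, ← hN]
    refine Finset.sum_congr rfl fun j hj => ?_
    have hj : j ≤ 2 * N := by have := Finset.mem_range.1 hj; lia
    rw [← qBinom_mul_pow_choose hq hq1 hj, mul_comm (qBinom q _ _), mul_assoc,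
      mul_comm (q ^ _)]
    have hsq : qBinom q (2 * N) j * qBinom q (2 * N) j * (q ^ (j * (j + 1) / 2)) ^ 2 = 1 := by
      have := qBinom_mul_pow_choose hq hq1 hj
      calc _ = (qBinom q (2 * N) j * q ^ (j * (j + 1) / 2)) ^ 2 := by ring
        _ = 1 := by rw [this, ← pow_mul, mul_comm, pow_mul]; simp
    have hdiv : j * (j + 1) / 2 * 2 = j * (j + 1) :=
      Nat.div_mul_cancel (Nat.even_mul_succ_self j).two_dvd
    have e : q ^ (j * (j + 1) / 2) * ψ ((j : ZMod d) * ((j : ZMod d) + 1)) = 1 := by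
      rw [hpow, ← AddChar.map_add_eq_mul]
      have : (2 : ZMod d) * ((j * (j + 1) / 2 : ℕ) : ZMod d) = j * (j + 1) := by
        have := congrArg (Nat.cast (R := ZMod d)) hdiv
        push_cast at this ⊢
        linear_combination this
      rw [this]; simp
    have hne : q ^ (j * (j + 1) / 2) ≠ 0 := left_ne_zero_of_mul_eq_one e
    apply mul_left_cancel₀ hne
    rw [e]
    linear_combination hsq
  have hshift : ∑ x : ZMod d, (ψ (x ^ 2) : ℂ) = ψ ((N : ZMod d) ^ 2) * qAltSum q (2 * N) := by
    rw [hsum, Finset.mul_sum, ← Equiv.sum_comp (Equiv.addRight (-(N : ZMod d)))]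
    refine Finset.sum_congr rfl fun x _ => ?_
    rw [← AddChar.map_add_eq_mul]
    congr 1
    simp only [Equiv.coe_addRight]
    linear_combination (-x) * hN2
  rw [hshift, qAltSum_two_mul hq, ← sum_range_odd, stdAddChar_sum,
    ← Finset.prod_mul_distrib]
  refine Finset.prod_congr rfl fun l _ => ?_
  rw [← stdAddChar_sub_stdAddChar_neg, hpow, mul_sub, ← AddChar.map_add_eq_mul]
  push_cast
  congr 2 <;> ring

/-- Up to a positive factor, the quadratic Gauss sum is `ε_d`: among the sines of the product
formula exactly `⌊d / 4⌋` are negative. -/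
lemma exists_pos_sum_stdAddChar_sq [Fact d.Prime] (hd : d ≠ 2) :
    ∃ P : ℝ, 0 < P ∧ ∑ x : ZMod d, (ψ (x ^ 2) : ℂ) = epsilon d * P := by
  have hodd : d % 2 = 1 := Nat.Prime.eq_two_or_odd Fact.out |>.resolve_left hd
  -- The product has `s` positive sines, with angles below `π`, followed by `r` negative ones.
  obtain ⟨s, r, hN, hs, heps⟩ : ∃ s r : ℕ, d = 2 * (s + r) + 1 ∧ (s = r ∨ s = r + 1) ∧
      epsilon d = Complex.I ^ (s + r) * (-1) ^ r := by
    rcases (by lia : d % 4 = 1 ∨ d % 4 = 3) with h | h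
    · refine ⟨d / 4, d / 4, by lia, Or.inl rfl, ?_⟩
      rw [epsilon, if_pos h, ← two_mul, pow_mul, Complex.I_sq, ← mul_pow]
      simp
    · refine ⟨d / 4 + 1, d / 4, by lia, Or.inr rfl, ?_⟩
      rw [epsilon, if_neg (by lia), add_right_comm, ← two_mul, pow_succ, pow_mul, Complex.I_sq,
        mul_right_comm, ← mul_pow]
      simp
  have hdpos : (0 : ℝ) < d := by exact_mod_cast (Fact.out : d.Prime).pos
  set a : ℕ → ℝ := fun l => 2 * Real.sin (2 * Real.pi * (2 * l + 1 : ℕ) / d) with ha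
  have hpos : ∀ l < s, 0 < a l := by
    intro l hl
    have hlt : ((2 * (2 * l + 1) : ℕ) : ℝ) < d := by exact_mod_cast (by lia)
    refine mul_pos two_pos (Real.sin_pos_of_pos_of_lt_pi (by positivity) ?_)
    rw [div_lt_iff₀ hdpos]
    push_cast at hlt ⊢
    nlinarith [Real.pi_pos]
  have hneg : ∀ l < r, 0 < -a (s + l) := by
    intro l hl
    have hlt : ((2 * (2 * (s + l) + 1) : ℕ) : ℝ) > d := by exact_mod_cast (by lia)
    have hlt2 : ((2 * (s + l) + 1 : ℕ) : ℝ) < d := by exact_mod_cast (by lia)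
    have hsin : Real.sin (2 * Real.pi * (2 * (s + l) + 1 : ℕ) / d) < 0 := by
      rw [← Real.sin_sub_two_pi]
      refine Real.sin_neg_of_neg_of_neg_pi_lt ?_ ?_
      · rw [sub_neg, div_lt_iff₀ hdpos]
        push_cast at hlt hlt2 ⊢
        nlinarith [Real.pi_pos]
      · rw [lt_sub_iff_add_lt, lt_div_iff₀ hdpos]
        push_cast at hlt hlt2 ⊢
        nlinarith [Real.pi_pos]
    simp only [ha]
    linarith
  refine ⟨(∏ l ∈ Finset.range s, a l) * ∏ l ∈ Finset.range r, (-a (s + l)),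
    mul_pos (Finset.prod_pos fun l hl => hpos l (Finset.mem_range.1 hl))
      (Finset.prod_pos fun l hl => hneg l (Finset.mem_range.1 hl)), ?_⟩
  rw [sum_stdAddChar_sq_eq_prod hN]
  have e : ∀ l : ℕ, (2 * Complex.I * (Real.sin (2 * Real.pi * (2 * l + 1 : ℕ) / d) : ℝ) : ℂ) =
      Complex.I * (a l : ℂ) := by
    intro l; simp only [ha]; push_cast; ring
  simp only [e]
  rw [Finset.prod_mul_distrib, Finset.prod_const, Finset.card_range, Finset.prod_range_add, heps]
  simp only [Finset.prod_neg, Finset.card_range]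
  push_cast
  have : ((-1 : ℂ) ^ r) * (-1) ^ r = 1 := by rw [← mul_pow]; simp
  linear_combination (-(Complex.I ^ (s + r) * (∏ l ∈ Finset.range s, (a l : ℂ)) *
    ∏ l ∈ Finset.range r, (a (s + l) : ℂ))) * this

/-- The Legendre symbol as a complex multiplicative character. -/
def legendreChar (d : ℕ) [Fact d.Prime] : MulChar (ZMod d) ℂ :=
  (quadraticChar (ZMod d)).ringHomComp (Int.castRingHom ℂ)

lemma legendreChar_natCast [Fact d.Prime] (n : ℕ) :
    legendreChar d (n : ZMod d) = (legendreSym d (n : ℤ) : ℂ) := by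
  simp [legendreChar, legendreSym]

/-- Counting square roots turns the quadratic exponential sum into the Gauss sum of the
Legendre symbol. -/
lemma sum_stdAddChar_mul_sq_eq_gaussSum [Fact d.Prime] (hd : d ≠ 2) {n : ZMod d} (hn : n ≠ 0) :
    ∑ x : ZMod d, (ψ (n * x ^ 2) : ℂ) = gaussSum (legendreChar d) (ZMod.stdAddChar.mulShift n) := by
  have hchar : ringChar (ZMod d) ≠ 2 := by rwa [ZMod.ringChar_zmod_n]
  have h1 : ∑ x : ZMod d, (ψ (n * x ^ 2) : ℂ) =
      ∑ a : ZMod d, (legendreChar d a + 1) * ψ (n * a) := by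
    rw [← Finset.sum_fiberwise_of_maps_to (t := Finset.univ) (g := fun x : ZMod d => x ^ 2)
      (fun _ _ => Finset.mem_univ _)]
    refine Finset.sum_congr rfl fun a _ => ?_
    have hcard := quadraticChar_card_sqrts hchar a
    have : (legendreChar d a + 1 : ℂ) =
        ((Finset.univ.filter fun x : ZMod d => x ^ 2 = a).card : ℂ) := by
      have h := congrArg (Int.cast (R := ℂ)) hcard
      push_cast at h
      rw [legendreChar, MulChar.ringHomComp_apply, eq_intCast, ← h]
      congr 2
      ext x; simp
    rw [this, Finset.sum_congr rfl (g := fun _ => (ψ (n * a) : ℂ))]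
    · rw [Finset.sum_const, nsmul_eq_mul]
    · intro x hx
      rw [(Finset.mem_filter.1 hx).2]
  have h2 : ∑ a : ZMod d, (ψ (n * a) : ℂ) = 0 := by
    have := AddChar.sum_mulShift n (ZMod.isPrimitive_stdAddChar d)
    simpa [mul_comm, hn] using this
  simp only [h1, add_mul, one_mul, Finset.sum_add_distrib, h2, add_zero, gaussSum,
    AddChar.mulShift_apply]

lemma epsilon_sq [Fact d.Prime] (hd : d ≠ 2) : epsilon d ^ 2 = legendreChar d (-1) := by
  have hodd : d % 2 = 1 := Nat.Prime.eq_two_or_odd Fact.out |>.resolve_left hd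
  have h : legendreChar d (-1) = (legendreSym d (-1) : ℂ) := by
    simp [legendreChar, legendreSym]
  rw [h, legendreSym.at_neg_one hd, epsilon]
  rcases (by lia : d % 4 = 1 ∨ d % 4 = 3) with h4 | h4
  · rw [if_pos h4, ZMod.χ₄_nat_one_mod_four h4]; simp
  · rw [if_neg (by lia), ZMod.χ₄_nat_three_mod_four h4]; simp

lemma norm_epsilon (d : ℕ) : ‖epsilon d‖ = 1 := by
  unfold epsilon; split_ifs <;> simp

/-- The quadratic Gauss sum `∑ₓ ω^(n x²) = (n/d) ε_d √d`, including its sign. -/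
lemma sum_stdAddChar_mul_sq [Fact d.Prime] (hd : d ≠ 2) {n : ZMod d} (hn : n ≠ 0) :
    ∑ x : ZMod d, (ψ (n * x ^ 2) : ℂ) = legendreChar d n * epsilon d * (√(d : ℝ) : ℝ) := by
  have hchar : ringChar (ZMod d) ≠ 2 := by rwa [ZMod.ringChar_zmod_n]
  have hquad : (legendreChar d).IsQuadratic :=
    (quadraticChar_isQuadratic (ZMod d)).comp _
  have hne : legendreChar d ≠ 1 :=
    MulChar.ringHomComp_ne_one_iff (Int.cast_injective (α := ℂ)) |>.2 (quadraticChar_ne_one hchar)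
  obtain ⟨P, hP, hsum⟩ := exists_pos_sum_stdAddChar_sq hd
  have hG1 := sum_stdAddChar_mul_sq_eq_gaussSum hd (one_ne_zero (α := ZMod d))
  simp only [one_mul, AddChar.mulShift_one] at hG1
  rw [hsum] at hG1
  have hsq := gaussSum_sq hne hquad (ZMod.isPrimitive_stdAddChar d)
  rw [← hG1, mul_pow, epsilon_sq hd, ZMod.card] at hsq
  have hu : legendreChar d (-1) ≠ 0 := by
    rw [← epsilon_sq hd]
    exact pow_ne_zero _ (norm_ne_zero_iff.1 (by rw [norm_epsilon]; norm_num))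
  have hP2 : P ^ 2 = d := by exact_mod_cast mul_left_cancel₀ hu hsq
  have hPd : √(d : ℝ) = P := by rw [← hP2, Real.sqrt_sq hP.le]
  have hshift := gaussSum_mulShift (legendreChar d) ZMod.stdAddChar (Units.mk0 n hn)
  simp only [Units.val_mk0] at hshift
  rw [← hG1] at hshift
  have hn2 : legendreChar d n * legendreChar d n = 1 := by
    rw [legendreChar, MulChar.ringHomComp_apply, ← map_mul, ← sq, quadraticChar_sq_one hn, map_one]
  rw [sum_stdAddChar_mul_sq_eq_gaussSum hd hn, hPd, mul_assoc, ← hshift, ← mul_assoc, hn2, one_mul]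

/-! ### The phases -/

/-- The complex number `ω ^ (-z / 48)`. -/
noncomputable def fracPhase (d : ℕ) (z : ℤ) : ℂ :=
  Complex.exp (2 * Real.pi * Complex.I / d * (-(z : ℂ) / 48))

lemma fracPhase_add (d : ℕ) (z w : ℤ) :
    fracPhase d (z + w) = fracPhase d z * fracPhase d w := by
  rw [fracPhase, fracPhase, fracPhase, ← Complex.exp_add]
  congr 1; push_cast; ring

lemma star_fracPhase (d : ℕ) (z : ℤ) : star (fracPhase d z) = fracPhase d (-z) := by
  rw [fracPhase, fracPhase, Complex.star_def, ← Complex.exp_conj]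
  congr 1
  simp [map_ofNat]
  ring

lemma norm_fracPhase (d : ℕ) (z : ℤ) : ‖fracPhase d z‖ = 1 := by
  rw [fracPhase, Complex.norm_exp]
  simp [Complex.div_re, Complex.div_im]

lemma fracPhase_mul_fortyEight [NeZero d] (w : ℤ) :
    fracPhase d (48 * w) = ψ (-(w : ZMod d)) := by
  have h := ZMod.stdAddChar_coe (N := d) (-w)
  push_cast at h
  rw [h, fracPhase]
  congr 1; push_cast; ring

lemma fracPhase_eq_one [NeZero d] {z : ℤ} (h : 48 * (d : ℤ) ∣ z) : fracPhase d z = 1 := by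
  obtain ⟨k, rfl⟩ := h
  rw [mul_assoc, fracPhase_mul_fortyEight]; simp

lemma fracPhase_congr [NeZero d] {z w : ℤ} (h : 48 * (d : ℤ) ∣ z - w) :
    fracPhase d z = fracPhase d w := by
  rw [← sub_add_cancel z w, fracPhase_add, fracPhase_eq_one h, one_mul]

/-- The integer `(1 - d²) n (n² + 3)`, which agrees with `g n d` modulo `48 d`. -/
def cubicExponent (d : ℕ) (n : ℤ) : ℤ := (1 - (d : ℤ) ^ 2) * (n * (n ^ 2 + 3))

/-- The four cases of `g` are one polynomial modulo `48 d`. -/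
lemma dvd_g_sub_cubicExponent (hd : d % 2 = 1) (n : ℕ) :
    48 * (d : ℤ) ∣ g n d - cubicExponent d n := by
  -- With `n = 2 m` or `n = 4 m + 1, 4 m + 3`, and `d` expressed through a parameter `t` by the
  -- parity condition on `(n + d + 1) / 2`, the four differences are explicit multiples of these.
  have h1 : ∀ m t : ℤ, 12 ∣ m * ((4 * t + 3 - 2 * m) * (2 * m ^ 2 + 1) - 3) := by
    intro m t
    refine (ZMod.intCast_zmod_eq_zero_iff_dvd _ 12).1 ?_
    push_cast
    generalize (m : ZMod 12) = x, (t : ZMod 12) = y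
    revert x y; decide
  have h2 : ∀ m t : ℤ, 12 ∣ m * ((4 * t + 1 - 2 * m) * (2 * m ^ 2 + 1) + 3) := by
    intro m t
    refine (ZMod.intCast_zmod_eq_zero_iff_dvd _ 12).1 ?_
    push_cast
    generalize (m : ZMod 12) = x, (t : ZMod 12) = y
    revert x y; decide
  have h3 : ∀ m : ℤ, 3 ∣ m * (m + 1) * (4 * m - 1) := by
    intro m
    refine (ZMod.intCast_zmod_eq_zero_iff_dvd _ 3).1 ?_
    push_cast
    generalize (m : ZMod 3) = x
    revert x; decide
  have h4 : ∀ m : ℤ, 3 ∣ (m + 1) * (4 * m ^ 2 + 5 * m + 3) := by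
    intro m
    refine (ZMod.intCast_zmod_eq_zero_iff_dvd _ 3).1 ?_
    push_cast
    generalize (m : ZMod 3) = x
    revert x; decide
  unfold g cubicExponent
  split_ifs with c1 c2 c3
  · obtain ⟨m, hm⟩ : ∃ m : ℤ, (n : ℤ) = 2 * m := ⟨n / 2, by lia⟩
    obtain ⟨t, ht⟩ : ∃ t : ℤ, (d : ℤ) = 4 * t + 3 - 2 * m := ⟨(d + 2 * m - 3) / 4, by lia⟩
    obtain ⟨k, hk⟩ := h1 m t
    rw [← ht] at hk
    refine ⟨k, ?_⟩
    rw [hm]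
    linear_combination (4 * (d : ℤ)) * hk
  · obtain ⟨m, hm⟩ : ∃ m : ℤ, (n : ℤ) = 2 * m := ⟨n / 2, by lia⟩
    obtain ⟨t, ht⟩ : ∃ t : ℤ, (d : ℤ) = 4 * t + 1 - 2 * m := ⟨(d + 2 * m - 1) / 4, by lia⟩
    obtain ⟨k, hk⟩ := h2 m t
    rw [← ht] at hk
    refine ⟨k, ?_⟩
    rw [hm]
    linear_combination (4 * (d : ℤ)) * hk
  · obtain ⟨m, hm⟩ : ∃ m : ℤ, (n : ℤ) = 4 * m + 1 := ⟨n / 4, by lia⟩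
    obtain ⟨k, hk⟩ := h3 m
    refine ⟨d * k, ?_⟩
    rw [hm]
    linear_combination (16 * (d : ℤ) ^ 2) * hk
  · obtain ⟨m, hm⟩ : ∃ m : ℤ, (n : ℤ) = 4 * m + 3 := ⟨n / 4, by lia⟩
    obtain ⟨k, hk⟩ := h4 m
    refine ⟨d * k, ?_⟩
    rw [hm]
    linear_combination (16 * (d : ℤ) ^ 2) * hk

/-- The phase `ω ^ (-(1 - d²) n (n² + 3) / 48)`, that is, `λ_n` without its factor
`[ε_d (n/d)]⁻¹`. -/
noncomputable def cubicPhase (d n : ℕ) : ℂ := fracPhase d (cubicExponent d n)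

lemma norm_cubicPhase (d n : ℕ) : ‖cubicPhase d n‖ = 1 := norm_fracPhase _ _

lemma phase_eq [Fact d.Prime] (hd : d ≠ 2) {n : ℕ} (hn : n ≠ 0) :
    phase d n = (legendreChar d n * epsilon d)⁻¹ * cubicPhase d n := by
  have hodd : d % 2 = 1 := Nat.Prime.eq_two_or_odd Fact.out |>.resolve_left hd
  rw [phase, if_neg hn, mul_comm (epsilon d), legendreChar_natCast]
  congr 1
  exact fracPhase_congr (dvd_g_sub_cubicExponent hodd n)

lemma cubicPhase_zero (d : ℕ) : cubicPhase d 0 = 1 := by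
  simp [cubicPhase, cubicExponent, fracPhase]

lemma cubicPhase_self [NeZero d] (hd : d % 2 = 1) : cubicPhase d d = 1 := by
  have h : ∀ e : ℤ, 3 ∣ e * (e + 1) * (e ^ 2 + e + 1) := by
    intro e
    refine (ZMod.intCast_zmod_eq_zero_iff_dvd _ 3).1 ?_
    push_cast
    generalize (e : ZMod 3) = x
    revert x; decide
  apply fracPhase_eq_one
  obtain ⟨e, he⟩ : ∃ e : ℤ, (d : ℤ) = 2 * e + 1 := ⟨d / 2, by lia⟩
  obtain ⟨k, hk⟩ := h e
  refine ⟨-k, ?_⟩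
  rw [cubicExponent, he]
  linear_combination (-16 * (2 * e + 1)) * hk

/-- The recursion of the cubic phases, with division in the field `ZMod d`. -/
lemma cubicPhase_succ [Fact d.Prime] (hd : d ≠ 2) (n : ℕ) :
    cubicPhase d (n + 1) =
      cubicPhase d 1 * cubicPhase d n * ψ (-((n : ZMod d) * ((n : ZMod d) + 1) / 16)) := by
  have hodd : d % 2 = 1 := Nat.Prime.eq_two_or_odd Fact.out |>.resolve_left hd
  have h2 := ne_zero_two (d := d) hd
  have h16 : (16 : ZMod d) ≠ 0 := by
    rw [show (16 : ZMod d) = 2 ^ 4 by norm_num]; exact pow_ne_zero _ h2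
  obtain ⟨e, he⟩ : ∃ e : ℤ, (d : ℤ) = 2 * e + 1 := ⟨d / 2, by lia⟩
  obtain ⟨t, ht⟩ := (Int.even_mul_succ_self e).two_dvd
  obtain ⟨s, hs⟩ := (Int.even_mul_succ_self (n : ℤ)).two_dvd
  have hw : cubicExponent d (n + 1 : ℕ) =
      cubicExponent d (1 : ℕ) + cubicExponent d n + 48 * (-t * s) := by
    simp only [cubicExponent, he]
    push_cast
    linear_combination (-12 * (n : ℤ) * (n + 1)) * ht - 24 * t * hs
  rw [cubicPhase, hw, fracPhase_add, fracPhase_add, fracPhase_mul_fortyEight]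
  have hz : ((-t * s : ℤ) : ZMod d) = (n : ZMod d) * ((n : ZMod d) + 1) / 16 := by
    rw [eq_div_iff h16]
    have h : (16 * (-t * s) : ℤ) = (1 - (d : ℤ) ^ 2) * (n * (n + 1)) := by
      rw [he]; linear_combination (4 * (n : ℤ) * (n + 1)) * ht + 8 * t * hs
    have := congrArg (Int.cast (R := ZMod d)) h
    push_cast at this ⊢
    simp only [CharP.cast_eq_zero] at this
    linear_combination this
  rw [hz]
  rfl

/-- The explicit phases are admissible. -/
lemma admissiblePhases_phase [Fact d.Prime] (hd : d ≠ 2) : AdmissiblePhases d (phase d) := by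
  have hodd : d % 2 = 1 := Nat.Prime.eq_two_or_odd Fact.out |>.resolve_left hd
  have hleg : ∀ n : ℕ, 1 ≤ n → n < d → legendreChar d n ^ 2 = 1 := by
    intro n h1 h2
    have hn0 : (n : ZMod d) ≠ 0 := by
      rw [Ne, ZMod.natCast_eq_zero_iff]
      exact fun h => absurd (Nat.le_of_dvd (by lia) h) (by lia)
    rw [legendreChar, MulChar.ringHomComp_apply, ← map_pow,
      quadraticChar_sq_one hn0, map_one]
  have heps4 : epsilon d ^ 4 = 1 := by
    unfold epsilon; split_ifs <;> simp
  refine ⟨fun n hn => ?_, by simp [phase], fun n h1 h2 => ?_⟩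
  · rcases Nat.eq_zero_or_pos n with rfl | h0
    · simp [phase]
    · rw [phase_eq hd (by lia), norm_mul, norm_inv, norm_mul, norm_epsilon, norm_cubicPhase]
      simp [Complex.norm_eq_one_of_pow_eq_one (hleg n h0 hn) two_ne_zero]
  · rw [phase_eq hd (by lia), phase_eq hd (by lia)]
    have hstar : star (cubicPhase d (d - n)) = cubicPhase d n := by
      rw [cubicPhase, star_fracPhase]
      refine (fracPhase_congr ?_).symm
      have h : ∀ e n : ℤ, 12 ∣ e * (e + 1) *
          (4 * e ^ 2 + 4 * e + 4 - 3 * (2 * e + 1) * n + 3 * n ^ 2) := by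
        intro e n
        refine (ZMod.intCast_zmod_eq_zero_iff_dvd _ 12).1 ?_
        push_cast
        generalize (e : ZMod 12) = x, (n : ZMod 12) = y
        revert x y; decide
      obtain ⟨e, he⟩ : ∃ e : ℤ, (d : ℤ) = 2 * e + 1 := ⟨d / 2, by lia⟩
      obtain ⟨k, hk⟩ := h e n
      refine ⟨-k, ?_⟩
      rw [cubicExponent, cubicExponent, Nat.cast_sub h2.le, he]
      linear_combination (-4 * (2 * e + 1)) * hk
    have hl : star (legendreChar d (d - n : ℕ)) = legendreChar d (-1) * legendreChar d n := by
      rw [← map_mul, Nat.cast_sub h2.le]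
      simp [legendreChar]
    have he : star (epsilon d) = epsilon d ^ 3 := by
      unfold epsilon; split_ifs
      · simp
      · simp [pow_succ]
    rw [star_mul', star_inv₀, star_mul', hstar, hl, he, ← epsilon_sq hd]
    congr 1
    rw [inv_inj]
    linear_combination (-(legendreChar d n * epsilon d)) * heps4

/-! ### The upper bound -/

section Kronecker

variable {ι κ α : Type*}

lemma sum_kronecker_right (s : Finset α) (A : Matrix ι ι ℂ) (B : α → Matrix κ κ ℂ) :
    A ⊗ₖ (∑ i ∈ s, B i) = ∑ i ∈ s, A ⊗ₖ B i := by
  ext p q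
  simp [Matrix.sum_apply, Finset.mul_sum]

lemma sum_kronecker_left (s : Finset α) (A : α → Matrix ι ι ℂ) (B : Matrix κ κ ℂ) :
    (∑ i ∈ s, A i) ⊗ₖ B = ∑ i ∈ s, A i ⊗ₖ B := by
  ext p q
  simp [Matrix.sum_apply, Finset.sum_mul]

lemma sub_kronecker (A A' : Matrix ι ι ℂ) (B : Matrix κ κ ℂ) :
    (A - A') ⊗ₖ B = A ⊗ₖ B - A' ⊗ₖ B := by
  ext p q
  simp [sub_mul]

lemma kronecker_sub (A : Matrix ι ι ℂ) (B B' : Matrix κ κ ℂ) :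
    A ⊗ₖ (B - B') = A ⊗ₖ B - A ⊗ₖ B' := by
  ext p q
  simp [mul_sub]

end Kronecker

lemma omega_pow [NeZero d] (n : ℕ) : omega d ^ n = ψ (n : ZMod d) := by
  have h := ZMod.stdAddChar_coe (N := d) n
  push_cast at h
  rw [h, omega, ← Complex.exp_nat_mul]
  congr 1; ring

lemma stdAddChar_mul_star [NeZero d] (x : ZMod d) : (ψ x : ℂ) * star (ψ x : ℂ) = 1 := by
  rw [Complex.star_def, ← AddChar.map_neg_eq_conj, ← AddChar.map_add_eq_mul]; simp

lemma star_stdAddChar [NeZero d] (x : ZMod d) : star (ψ x : ℂ) = ψ (-x) := by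
  rw [Complex.star_def, ← AddChar.map_neg_eq_conj]

section Measurement

variable {ι κ : Type*} [Fintype ι] [DecidableEq ι] [Fintype κ] [DecidableEq κ]

lemma Measurement.fourier_eq [NeZero d] (M : Measurement d ι) (n : ℕ) :
    M.fourier n = ∑ a : Fin d, (ψ (((a : ℕ) * n : ℕ) : ZMod d) : ℂ) • M.F a := by
  simp only [Measurement.fourier, omega_pow]

lemma Measurement.fourier_zero (M : Measurement d ι) : M.fourier 0 = 1 := by
  simp [Measurement.fourier, M.sum_eq_one]

/-- A weighted sum of the effects of a measurement with weights of modulus one is a contraction: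
`1 - A Aᴴ = ∑ₐ (zₐ - A) Fₐ (zₐ - A)ᴴ`. -/
lemma Measurement.posSemidef_one_sub_mul_conjTranspose (M : Measurement d ι) (z : Fin d → ℂ)
    (hz : ∀ a, z a * star (z a) = 1) :
    (1 - (∑ a, z a • M.F a) * (∑ a, z a • M.F a)ᴴ).PosSemidef := by
  set A := ∑ a, z a • M.F a with hA
  have hAH : Aᴴ = ∑ a, star (z a) • M.F a := by
    rw [hA, Matrix.conjTranspose_sum]
    exact Finset.sum_congr rfl fun a _ => by
      rw [Matrix.conjTranspose_smul, (M.posSemidef a).isHermitian.eq]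
  have h : 1 - A * Aᴴ = ∑ a, (z a • 1 - A) * M.F a * (z a • 1 - A)ᴴ := by
    have e : ∀ a, (z a • 1 - A) * M.F a * (z a • 1 - A)ᴴ =
        M.F a - (z a • M.F a) * Aᴴ - A * (star (z a) • M.F a) + A * M.F a * Aᴴ := by
      intro a
      rw [Matrix.conjTranspose_sub, Matrix.conjTranspose_smul, Matrix.conjTranspose_one]
      simp only [sub_mul, mul_sub, smul_mul_assoc, mul_smul_comm, one_mul, mul_one, smul_sub,
        smul_smul, mul_comm (star (z a)), hz, one_smul]
      abel
    simp only [e, Finset.sum_add_distrib, Finset.sum_sub_distrib, ← Finset.sum_mul,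
      ← Finset.mul_sum, M.sum_eq_one, ← hA, ← hAH, mul_one]
    abel
  rw [h]
  exact Matrix.posSemidef_sum _ fun a _ => (M.posSemidef a).mul_mul_conjTranspose_same _

lemma Measurement.posSemidef_one_sub_fourier_mul [NeZero d] (M : Measurement d ι) (n : ℕ) :
    (1 - M.fourier n * (M.fourier n)ᴴ).PosSemidef := by
  rw [M.fourier_eq]
  exact M.posSemidef_one_sub_mul_conjTranspose _ fun a => stdAddChar_mul_star _

lemma Measurement.posSemidef_one_sub_mul_fourier [NeZero d] (M : Measurement d ι) (n : ℕ) :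
    (1 - (M.fourier n)ᴴ * M.fourier n).PosSemidef := by
  have h := M.posSemidef_one_sub_mul_conjTranspose
    (fun a => star (ψ (((a : ℕ) * n : ℕ) : ZMod d) : ℂ))
    fun a => by rw [star_star, mul_comm, stdAddChar_mul_star]
  have e : (∑ a : Fin d, star (ψ (((a : ℕ) * n : ℕ) : ZMod d) : ℂ) • M.F a) = (M.fourier n)ᴴ := by
    rw [M.fourier_eq, Matrix.conjTranspose_sum]
    exact Finset.sum_congr rfl fun a _ => by
      rw [Matrix.conjTranspose_smul, (M.posSemidef a).isHermitian.eq]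
  rwa [e, Matrix.conjTranspose_conjTranspose] at h

/-- The operators `C_j^{(n)} = (λ_n / √d) ∑_k ω^{n j k} B_k^{(n)}` of arbitrary measurements. -/
noncomputable def dualOp (lam : ℕ → ℂ) (MB : Fin d → Measurement d κ) (j : Fin d) (n : ℕ) :
    Matrix κ κ ℂ :=
  (lam n / ((√(d : ℝ) : ℝ) : ℂ)) •
    ∑ k : Fin d, omega d ^ (n * (j : ℕ) * (k : ℕ)) • (MB k).fourier n

lemma sqrt_natCast_mul_self (d : ℕ) : ((√(d : ℝ) : ℝ) : ℂ) * ((√(d : ℝ) : ℝ) : ℂ) = d := by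
  rw [← Complex.ofReal_mul, Real.mul_self_sqrt (by positivity), Complex.ofReal_natCast]

lemma sqrt_natCast_ne_zero [NeZero d] : ((√(d : ℝ) : ℝ) : ℂ) ≠ 0 := by
  intro h
  have := sqrt_natCast_mul_self d
  rw [h, mul_zero] at this
  exact NeZero.ne (d : ℂ) this.symm

lemma bellOperator_eq_dualOp [NeZero d] {lam : ℕ → ℂ} (hlam : lam 0 = 1)
    (MA : Fin d → Measurement d ι) (MB : Fin d → Measurement d κ) :
    bellOperator d lam MA MB = (1 / (d : ℂ)) • 1 +
      (((√(d : ℝ) : ℝ) : ℂ) / (d : ℂ) ^ 3) •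
        ∑ n ∈ Finset.Ico 1 d, ∑ j, (MA j).fourier n ⊗ₖ dualOp lam MB j n := by
  have hd : (d : ℂ) ≠ 0 := NeZero.ne _
  have hs : ((√(d : ℝ) : ℝ) : ℂ) ≠ 0 := sqrt_natCast_ne_zero
  rw [bellOperator, Finset.range_eq_Ico,
    Finset.sum_eq_sum_Ico_succ_bot (Nat.pos_of_ne_zero (NeZero.ne d)), smul_add]
  congr 1
  · simp only [hlam, Measurement.fourier_zero, zero_mul, pow_zero, one_smul, Finset.sum_const,
      Finset.card_univ, Fintype.card_fin, Matrix.one_kronecker_one, ← Nat.cast_smul_eq_nsmul ℂ,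
      smul_smul]
    congr 1
    field_simp
  · rw [zero_add, show ((√(d : ℝ) : ℝ) : ℂ) / (d : ℂ) ^ 3 =
      1 / (d : ℂ) ^ 3 * ((√(d : ℝ) : ℝ) : ℂ) by ring, mul_smul]
    congr 1
    rw [Finset.smul_sum]
    refine Finset.sum_congr rfl fun n _ => ?_
    rw [Finset.smul_sum, Finset.smul_sum]
    refine Finset.sum_congr rfl fun j _ => ?_
    rw [dualOp, Matrix.kronecker_smul, smul_smul, mul_div_cancel₀ _ hs, sum_kronecker_right]
    simp only [Matrix.kronecker_smul]

/-- The Parseval identity `∑_j C_jᴴ C_j = ∑_k B_kᴴ B_k` for the transform of Bob's operators. -/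
lemma sum_conjTranspose_dualOp_mul [Fact d.Prime] {lam : ℕ → ℂ} {n : ℕ} (hlam : ‖lam n‖ = 1)
    (h1 : 1 ≤ n) (hn : n < d) (MB : Fin d → Measurement d κ) :
    ∑ j, (dualOp lam MB j n)ᴴ * dualOp lam MB j n =
      ∑ k, ((MB k).fourier n)ᴴ * (MB k).fourier n := by
  have hd : (d : ℂ) ≠ 0 := NeZero.ne _
  have hn0 : (n : ZMod d) ≠ 0 := by
    rw [Ne, ZMod.natCast_eq_zero_iff]
    exact fun h => absurd (Nat.le_of_dvd (by lia) h) (by lia)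
  have hc : star (lam n / ((√(d : ℝ) : ℝ) : ℂ)) * (lam n / ((√(d : ℝ) : ℝ) : ℂ)) = 1 / d := by
    have h1 : star (lam n) * lam n = 1 := by
      rw [Complex.star_def, Complex.conj_mul', hlam]; simp
    rw [star_div₀, div_mul_div_comm, h1, Complex.star_def, Complex.conj_ofReal,
      sqrt_natCast_mul_self]
  -- orthogonality of the characters `j ↦ ω^(n j k)` for distinct `k`
  have horth : ∀ k k' : Fin d, ∑ j : Fin d,
      star (omega d ^ (n * (j : ℕ) * (k : ℕ))) * omega d ^ (n * (j : ℕ) * (k' : ℕ)) =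
        if k = k' then (d : ℂ) else 0 := by
    intro k k'
    simp only [omega_pow, star_stdAddChar, ← AddChar.map_add_eq_mul]
    rw [Fin.sum_univ_eq_sum_range (fun j => (ψ (-((n * j * k : ℕ) : ZMod d) +
      ((n * j * k' : ℕ) : ZMod d)) : ℂ))]
    have := sum_range_natCast (d := d) fun x => 
      (ψ (x * ((n : ZMod d) * (((k' : ℕ) : ZMod d) - ((k : ℕ) : ZMod d)))) : ℂ)
    rw [AddChar.sum_mulShift _ (ZMod.isPrimitive_stdAddChar d), ZMod.card] at this
    have hiff : ((n : ZMod d) * (((k' : ℕ) : ZMod d) - ((k : ℕ) : ZMod d)) = 0) ↔ k = k' := by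
      rw [mul_eq_zero, or_iff_right hn0, sub_eq_zero, ZMod.natCast_eq_natCast_iff',
        Nat.mod_eq_of_lt k.2, Nat.mod_eq_of_lt k'.2, Fin.ext_iff, eq_comm]
    simp only [hiff] at this
    rw [Nat.cast_ite, Nat.cast_zero] at this
    rw [← this]
    · refine Finset.sum_congr rfl fun j _ => ?_
      congr 1; push_cast; ring
  have e : ∀ j, (dualOp lam MB j n)ᴴ * dualOp lam MB j n = ∑ k : Fin d, ∑ k' : Fin d, (1 / (d : ℂ) *
      (star (omega d ^ (n * (j : ℕ) * (k : ℕ))) * omega d ^ (n * (j : ℕ) * (k' : ℕ)))) •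
        (((MB k).fourier n)ᴴ * (MB k').fourier n) := by
    intro j
    rw [dualOp, Matrix.conjTranspose_smul, smul_mul_smul_comm, hc, Matrix.conjTranspose_sum,
      Finset.sum_mul_sum, Finset.smul_sum]
    refine Finset.sum_congr rfl fun k _ => ?_
    rw [Finset.smul_sum]
    refine Finset.sum_congr rfl fun k' _ => ?_
    rw [Matrix.conjTranspose_smul, smul_mul_smul_comm, smul_smul]
  simp only [e]
  rw [Finset.sum_comm]
  refine Finset.sum_congr rfl fun k _ => ?_
  rw [Finset.sum_comm]
  simp only [← Finset.sum_smul, ← Finset.mul_sum, horth]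
  simp [hd]

lemma sum_Ico_one_reflect {M : Type*} [AddCommMonoid M] (d : ℕ) (f : ℕ → M) :
    ∑ n ∈ Finset.Ico 1 d, f n = ∑ n ∈ Finset.Ico 1 d, f (d - n) := by
  refine Finset.sum_nbij' (fun n => d - n) (fun n => d - n) ?_ ?_ ?_ ?_ ?_ <;>
    intro n hn <;> have := Finset.mem_Ico.1 hn
  · simp; lia
  · simp; lia
  · lia
  · lia
  · congr 1; lia

/-- The Bell coefficients are real, since conjugation exchanges the terms `n` and `d - n`. -/
lemma star_bellCoeff [NeZero d] {lam : ℕ → ℂ} (hlam : AdmissiblePhases d lam)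
    (a b j k : Fin d) : star (bellCoeff d lam a b j k) = bellCoeff d lam a b j k := by
  obtain ⟨-, h0, hsym⟩ := hlam
  rw [bellCoeff, star_mul', star_sum, Finset.range_eq_Ico,
    Finset.sum_eq_sum_Ico_succ_bot (Nat.pos_of_ne_zero (NeZero.ne d)),
    Finset.sum_eq_sum_Ico_succ_bot (Nat.pos_of_ne_zero (NeZero.ne d)), zero_add,
    sum_Ico_one_reflect d fun n => star (_ : ℂ)]
  congr 1
  · simp
  · congr 1
    · simp [h0]
    · refine Finset.sum_congr rfl fun n hn => ?_
      have hn := Finset.mem_Ico.1 hn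
      rw [star_mul', ← hsym n hn.1 hn.2, omega_pow, omega_pow, star_stdAddChar]
      congr 2
      push_cast [Nat.cast_sub hn.2.le]
      simp

lemma sum_rotate {M α β γ δ : Type*} [AddCommMonoid M] (s : Finset α) (t : Finset β)
    (u : Finset γ) (v : Finset δ) (f : α → β → γ → δ → M) :
    ∑ n ∈ s, ∑ j ∈ t, ∑ k ∈ u, ∑ a ∈ v, f n j k a =
      ∑ a ∈ v, ∑ n ∈ s, ∑ j ∈ t, ∑ k ∈ u, f n j k a :=
  (Finset.sum_congr rfl fun _ _ =>
    (Finset.sum_congr rfl fun _ _ => Finset.sum_comm).trans Finset.sum_comm).trans Finset.sum_comm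

lemma bellOperator_eq_sum (lam : ℕ → ℂ)
    (MA : Fin d → Measurement d ι) (MB : Fin d → Measurement d κ) :
    bellOperator d lam MA MB = ∑ a : Fin d, ∑ b : Fin d, ∑ j : Fin d, ∑ k : Fin d,
      bellCoeff d lam a b j k • ((MA j).F a ⊗ₖ (MB k).F b) := by
  have hL : bellOperator d lam MA MB = ∑ n ∈ Finset.range d, ∑ j : Fin d, ∑ k : Fin d,
      ∑ a : Fin d, ∑ b : Fin d,
        (1 / (d : ℂ) ^ 3 * (lam n * omega d ^ (n * ((a : ℕ) + (b : ℕ) + (j : ℕ) * (k : ℕ))))) •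
          ((MA j).F a ⊗ₖ (MB k).F b) := by
    simp only [bellOperator, Finset.smul_sum]
    refine Finset.sum_congr rfl fun n _ => Finset.sum_congr rfl fun j _ =>
      Finset.sum_congr rfl fun k _ => ?_
    rw [Measurement.fourier, Measurement.fourier, sum_kronecker_left, Finset.smul_sum,
      Finset.smul_sum, Finset.smul_sum]
    refine Finset.sum_congr rfl fun a _ => ?_
    rw [sum_kronecker_right, Finset.smul_sum, Finset.smul_sum, Finset.smul_sum]
    refine Finset.sum_congr rfl fun b _ => ?_
    rw [Matrix.smul_kronecker, Matrix.kronecker_smul, smul_smul, smul_smul, smul_smul, smul_smul]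
    congr 1
    ring
  rw [hL, sum_rotate]
  refine Finset.sum_congr rfl fun a _ => ?_
  rw [sum_rotate]
  refine Finset.sum_congr rfl fun b _ => ?_
  rw [Finset.sum_comm]
  refine Finset.sum_congr rfl fun j _ => ?_
  rw [Finset.sum_comm]
  refine Finset.sum_congr rfl fun k _ => ?_
  rw [bellCoeff, Finset.mul_sum, Finset.sum_smul]

lemma conjTranspose_bellOperator [NeZero d] {lam : ℕ → ℂ} (hlam : AdmissiblePhases d lam)
    (MA : Fin d → Measurement d ι) (MB : Fin d → Measurement d κ) :
    (bellOperator d lam MA MB)ᴴ = bellOperator d lam MA MB := by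
  simp only [bellOperator_eq_sum, Matrix.conjTranspose_sum, Matrix.conjTranspose_smul,
    star_bellCoeff hlam, Matrix.conjTranspose_kronecker,
    ((MA _).posSemidef _).isHermitian.eq, ((MB _).posSemidef _).isHermitian.eq]

lemma posSemidef_smul_real {η : Type*} {A : Matrix η η ℂ} (hA : A.PosSemidef) {r : ℝ} (hr : 0 ≤ r) :
    ((r : ℂ) • A).PosSemidef :=
  hA.smul (Complex.zero_le_real.2 hr)

/-- The sum-of-squares bound: `2 d (d - 1) - T - Tᴴ` is a sum of positive operators, where
`T = ∑_{n ≥ 1} ∑_j A_j^{(n)} ⊗ C_j^{(n)}`. -/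
lemma posSemidef_sub_sum_kronecker_dualOp [Fact d.Prime] {lam : ℕ → ℂ}
    (hlam : AdmissiblePhases d lam)
    (MA : Fin d → Measurement d ι) (MB : Fin d → Measurement d κ) :
    ((2 * d * (d - 1) : ℂ) • (1 : Matrix (ι × κ) (ι × κ) ℂ) -
      (∑ n ∈ Finset.Ico 1 d, ∑ j, (MA j).fourier n ⊗ₖ dualOp lam MB j n) -
      (∑ n ∈ Finset.Ico 1 d, ∑ j, (MA j).fourier n ⊗ₖ dualOp lam MB j n)ᴴ).PosSemidef := by
  set R : ℕ → Fin d → Matrix (ι × κ) (ι × κ) ℂ := fun n j =>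
    ((MA j).fourier n)ᴴ ⊗ₖ 1 - 1 ⊗ₖ dualOp lam MB j n with hR
  have hRR : ∀ n j, (R n j)ᴴ * R n j =
      ((MA j).fourier n * ((MA j).fourier n)ᴴ) ⊗ₖ 1 - (MA j).fourier n ⊗ₖ dualOp lam MB j n -
        ((MA j).fourier n ⊗ₖ dualOp lam MB j n)ᴴ +
        1 ⊗ₖ ((dualOp lam MB j n)ᴴ * dualOp lam MB j n) := by
    intro n j
    simp only [hR, Matrix.conjTranspose_sub, Matrix.conjTranspose_kronecker,
      Matrix.conjTranspose_conjTranspose, Matrix.conjTranspose_one, sub_mul, mul_sub,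
      ← Matrix.mul_kronecker_mul, one_mul, mul_one]
    abel
  have key : ((2 * d * (d - 1) : ℂ) • (1 : Matrix (ι × κ) (ι × κ) ℂ) -
      (∑ n ∈ Finset.Ico 1 d, ∑ j, (MA j).fourier n ⊗ₖ dualOp lam MB j n) -
      (∑ n ∈ Finset.Ico 1 d, ∑ j, (MA j).fourier n ⊗ₖ dualOp lam MB j n)ᴴ) =
      ∑ n ∈ Finset.Ico 1 d, (∑ j, (1 - (MA j).fourier n * ((MA j).fourier n)ᴴ) ⊗ₖ 1 +
        ∑ k, 1 ⊗ₖ (1 - ((MB k).fourier n)ᴴ * (MB k).fourier n) + ∑ j, (R n j)ᴴ * R n j) := by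
    have hterm : ∀ n ∈ Finset.Ico 1 d,
        (∑ j, (1 - (MA j).fourier n * ((MA j).fourier n)ᴴ) ⊗ₖ 1 +
          ∑ k, 1 ⊗ₖ (1 - ((MB k).fourier n)ᴴ * (MB k).fourier n) + ∑ j, (R n j)ᴴ * R n j) =
        (2 * d : ℂ) • (1 : Matrix (ι × κ) (ι × κ) ℂ) -
          (∑ j, (MA j).fourier n ⊗ₖ dualOp lam MB j n) -
          ∑ j, ((MA j).fourier n ⊗ₖ dualOp lam MB j n)ᴴ := by
      intro n hn
      have hn := Finset.mem_Ico.1 hn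
      have hpars := congrArg (fun X => (1 : Matrix ι ι ℂ) ⊗ₖ X)
        (sum_conjTranspose_dualOp_mul (hlam.1 n hn.2) hn.1 hn.2 MB)
      simp only [sum_kronecker_right] at hpars
      simp only [hRR, Finset.sum_add_distrib, Finset.sum_sub_distrib, hpars,
        sub_kronecker, kronecker_sub, Matrix.one_kronecker_one, Finset.sum_const,
        Finset.card_univ, Fintype.card_fin, two_mul, add_smul, Nat.cast_smul_eq_nsmul]
      abel
    rw [Finset.sum_congr rfl hterm]
    simp only [Finset.sum_sub_distrib, Matrix.conjTranspose_sum, Finset.sum_const, Nat.card_Ico,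
      ← Nat.cast_smul_eq_nsmul ℂ, smul_smul]
    rw [Nat.cast_sub (Fact.out : d.Prime).one_le]
    congr 3
    push_cast; ring
  rw [key]
  refine Matrix.posSemidef_sum _ fun n _ => ((Matrix.posSemidef_sum _ fun j _ => ?_).add
    (Matrix.posSemidef_sum _ fun k _ => ?_)).add
    (Matrix.posSemidef_sum _ fun j _ => Matrix.posSemidef_conjTranspose_mul_self _)
  · exact ((MA j).posSemidef_one_sub_fourier_mul n).kronecker Matrix.PosSemidef.one
  · exact Matrix.PosSemidef.one.kronecker ((MB k).posSemidef_one_sub_mul_fourier n)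

/-- The Bell operator is at most `1/d + (d-1)/(d√d)`. -/
lemma bellOperator_le [Fact d.Prime] {lam : ℕ → ℂ} (hlam : AdmissiblePhases d lam)
    (MA : Fin d → Measurement d ι) (MB : Fin d → Measurement d κ) :
    bellOperator d lam MA MB ≤ ((optimalValue d : ℝ) : ℂ) • (1 : Matrix (ι × κ) (ι × κ) ℂ) := by
  have hd : (d : ℂ) ≠ 0 := NeZero.ne _
  have hs : ((√(d : ℝ) : ℝ) : ℂ) ≠ 0 := sqrt_natCast_ne_zero
  rw [Matrix.le_iff]
  have hK := posSemidef_sub_sum_kronecker_dualOp hlam MA MB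
  have hW := bellOperator_eq_dualOp hlam.2.1 MA MB
  have hWH := conjTranspose_bellOperator hlam MA MB
  set T := ∑ n ∈ Finset.Ico 1 d, ∑ j, (MA j).fourier n ⊗ₖ dualOp lam MB j n
  set W := bellOperator d lam MA MB
  -- The sum of squares only bounds the Hermitian part, which is all of `W`.
  have hW2 : W = (1 / 2 : ℂ) • (W + Wᴴ) := by
    rw [hWH, ← two_smul ℂ, smul_smul]; norm_num
  have hr : (0 : ℝ) ≤ √(d : ℝ) / (2 * d ^ 3) := by positivity
  suffices h : ((optimalValue d : ℝ) : ℂ) • (1 : Matrix (ι × κ) (ι × κ) ℂ) - W =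
      ((√(d : ℝ) / (2 * d ^ 3) : ℝ) : ℂ) • ((2 * d * (d - 1) : ℂ) • 1 - T - Tᴴ) by
    rw [h]; exact posSemidef_smul_real hK hr
  have hstar : star (((√(d : ℝ) : ℝ) : ℂ) / (d : ℂ) ^ 3) = ((√(d : ℝ) : ℝ) : ℂ) / (d : ℂ) ^ 3 := by
    simp
  have hstar' : star (1 / (d : ℂ)) = 1 / (d : ℂ) := by simp
  rw [hW2, hW, Matrix.conjTranspose_add, Matrix.conjTranspose_smul, Matrix.conjTranspose_smul,
    Matrix.conjTranspose_one, hstar, hstar']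
  have hopt : ((optimalValue d : ℝ) : ℂ) =
      1 / d + ((√(d : ℝ) / (2 * d ^ 3) : ℝ) : ℂ) * (2 * d * (d - 1)) := by
    rw [optimalValue]
    push_cast
    rw [← sub_eq_zero]
    field_simp
    linear_combination (-((d : ℂ) - 1)) * sqrt_natCast_mul_self d
  rw [hopt]
  push_cast
  module

end Measurement

/-! ### Measurements from unitary representations of `ZMod d` -/

lemma sum_fin_natCast [NeZero d] {M : Type*} [AddCommMonoid M] (f : ZMod d → M) :
    ∑ k : Fin d, f ((k : ℕ) : ZMod d) = ∑ x, f x := by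
  rw [Fin.sum_univ_eq_sum_range (fun k => f (k : ZMod d)), sum_range_natCast]

lemma natCast_fin_inj [NeZero d] (a b : Fin d) :
    ((a : ℕ) : ZMod d) = ((b : ℕ) : ZMod d) ↔ a = b := by
  rw [ZMod.natCast_eq_natCast_iff', Nat.mod_eq_of_lt a.2, Nat.mod_eq_of_lt b.2, Fin.ext_iff]

lemma sum_stdAddChar_mul [NeZero d] (a : ZMod d) :
    ∑ x : ZMod d, (ψ (a * x) : ℂ) = if a = 0 then (d : ℂ) else 0 := by
  have := AddChar.sum_mulShift a (ZMod.isPrimitive_stdAddChar d)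
  simpa [mul_comm] using this

section Spectral

variable {ι : Type*} [Fintype ι] [DecidableEq ι]

/-- A unitary matrix representation of the additive group `ZMod d`. -/
structure IsUnitaryRep (V : ZMod d → Matrix ι ι ℂ) : Prop where
  map_zero : V 0 = 1
  map_add : ∀ x y, V (x + y) = V x * V y
  conjTranspose : ∀ x, (V x)ᴴ = V (-x)

/-- The projector `d⁻¹ ∑ₓ ω^(-a x) V x` onto the isotypic component of the character
`x ↦ ω^(a x)`. -/
noncomputable def isotypicProj [NeZero d] (V : ZMod d → Matrix ι ι ℂ) (a : ZMod d) :
    Matrix ι ι ℂ :=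
  (1 / (d : ℂ)) • ∑ x, (ψ (-(a * x)) : ℂ) • V x

variable [NeZero d] {V W : ZMod d → Matrix ι ι ℂ}

lemma isotypicProj_mul (hV : IsUnitaryRep V) (a b : ZMod d) :
    isotypicProj V a * isotypicProj V b = if a = b then isotypicProj V a else 0 := by
  have hd : (d : ℂ) ≠ 0 := NeZero.ne _
  have h : (∑ x, (ψ (-(a * x)) : ℂ) • V x) * (∑ y, (ψ (-(b * y)) : ℂ) • V y) =
      ∑ z, ((∑ x, (ψ ((b - a) * x) : ℂ)) * ψ (-(b * z))) • V z := by
    rw [Finset.sum_mul_sum]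
    simp only [Finset.sum_mul, Finset.sum_smul]
    rw [Finset.sum_comm (s := Finset.univ) (t := Finset.univ)
      (f := fun z x => ((ψ ((b - a) * x) : ℂ) * ψ (-(b * z))) • V z)]
    refine Finset.sum_congr rfl fun x _ => ?_
    refine Eq.trans ?_ (Equiv.sum_comp (Equiv.addLeft x) _)
    refine Finset.sum_congr rfl fun y _ => ?_
    rw [smul_mul_smul_comm, Equiv.coe_addLeft, hV.map_add, ← AddChar.map_add_eq_mul,
      ← AddChar.map_add_eq_mul]
    congr 2
    ring
  rw [isotypicProj, isotypicProj, smul_mul_smul_comm, h]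
  simp only [sum_stdAddChar_mul, sub_eq_zero, eq_comm (a := b)]
  split_ifs with hab
  · subst hab
    simp only [← smul_smul, ← Finset.smul_sum]
    simp only [smul_smul]
    congr 1
    field_simp
  · simp

lemma conjTranspose_isotypicProj (hV : IsUnitaryRep V) (a : ZMod d) :
    (isotypicProj V a)ᴴ = isotypicProj V a := by
  rw [isotypicProj, Matrix.conjTranspose_smul, Matrix.conjTranspose_sum,
    ← Equiv.sum_comp (Equiv.neg (ZMod d))]
  congr 1
  · simp
  · refine Finset.sum_congr rfl fun x _ => ?_
    rw [Matrix.conjTranspose_smul, star_stdAddChar, hV.conjTranspose]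
    simp

lemma sum_smul_isotypicProj {η : Type*} (V : ZMod d → Matrix η η ℂ) (n : ZMod d) :
    ∑ a, (ψ (a * n) : ℂ) • isotypicProj V a = V n := by
  have hd : (d : ℂ) ≠ 0 := NeZero.ne _
  have e : ∀ a, (ψ (a * n) : ℂ) • isotypicProj V a =
      ∑ x, (1 / (d : ℂ) * ψ ((n - x) * a)) • V x := by
    intro a
    rw [isotypicProj, smul_comm, Finset.smul_sum, Finset.smul_sum]
    refine Finset.sum_congr rfl fun x _ => ?_
    rw [smul_smul, smul_smul, mul_assoc, ← AddChar.map_add_eq_mul]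
    congr 3
    ring
  simp only [e]
  rw [Finset.sum_comm]
  simp only [← Finset.sum_smul, ← Finset.mul_sum, sum_stdAddChar_mul, sub_eq_zero]
  simp [hd]

/-- The projective measurement of a unitary representation of `ZMod d`. -/
noncomputable def IsUnitaryRep.measurement (hV : IsUnitaryRep V) : Measurement d ι where
  F a := isotypicProj V ((a : ℕ) : ZMod d)
  posSemidef a := by
    have h := isotypicProj_mul hV ((a : ℕ) : ZMod d) ((a : ℕ) : ZMod d)
    rw [if_pos rfl] at h
    have h2 := Matrix.posSemidef_conjTranspose_mul_self (isotypicProj V ((a : ℕ) : ZMod d))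
    rwa [conjTranspose_isotypicProj hV, h] at h2
  sum_eq_one := by
    rw [sum_fin_natCast (fun a => isotypicProj V a), ← hV.map_zero, ← sum_smul_isotypicProj V 0]
    simp

lemma IsUnitaryRep.fourier_measurement (hV : IsUnitaryRep V) (n : ℕ) :
    hV.measurement.fourier n = V n := by
  rw [Measurement.fourier_eq, ← sum_smul_isotypicProj V]
  push_cast
  exact sum_fin_natCast fun a : ZMod d => (ψ (a * (n : ZMod d)) : ℂ) • isotypicProj V a

lemma IsUnitaryRep.isProjective_measurement (hV : IsUnitaryRep V) :
    hV.measurement.IsProjective := by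
  intro a b
  rw [IsUnitaryRep.measurement]
  simp only [isotypicProj_mul hV, natCast_fin_inj]

lemma rank_eq_trace_of_isIdempotentElem {P : Matrix ι ι ℂ} (hP : P * P = P) :
    (P.rank : ℂ) = P.trace := by
  have hid : IsIdempotentElem (Matrix.toLin' P) := by
    rw [IsIdempotentElem, Module.End.mul_eq_comp, ← Matrix.toLin'_mul, hP]
  have h := (LinearMap.IsIdempotentElem.isProj_range _ hid).trace
  rw [Matrix.trace_toLin'_eq] at h
  rw [h, Matrix.rank]
  rfl

lemma trace_isotypicProj (hV : IsUnitaryRep V) (htr : ∀ x, x ≠ 0 → (V x).trace = 0)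
    (hι : Fintype.card ι = d) (a : ZMod d) : (isotypicProj V a).trace = 1 := by
  have hd : (d : ℂ) ≠ 0 := NeZero.ne _
  rw [isotypicProj, Matrix.trace_smul, Matrix.trace_sum,
    Finset.sum_eq_single_of_mem 0 (Finset.mem_univ _)]
  · simp [hV.map_zero, hι, hd]
  · intro x _ hx
    rw [Matrix.trace_smul, htr x hx, smul_zero]

lemma IsUnitaryRep.isRankOneProjective_measurement (hV : IsUnitaryRep V)
    (htr : ∀ x, x ≠ 0 → (V x).trace = 0) (hι : Fintype.card ι = d) :
    hV.measurement.IsRankOneProjective := by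
  refine ⟨hV.isProjective_measurement, fun a => ?_⟩
  have h := hV.isProjective_measurement a a
  rw [if_pos rfl] at h
  have h2 := rank_eq_trace_of_isIdempotentElem h
  rw [IsUnitaryRep.measurement, trace_isotypicProj hV htr hι] at h2
  exact_mod_cast h2

/-- A Hermitian projector of trace one is the projector onto any unit vector it fixes. -/
lemma eq_vecMulVec_of_trace_eq_one {η : Type*} [Fintype η] {P : Matrix η η ℂ}
    (hP : P * P = P) (hH : Pᴴ = P)
    (htr : P.trace = 1) {u : η → ℂ} (hu : star u ⬝ᵥ u = 1) (hPu : P *ᵥ u = u) :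
    P = Matrix.vecMulVec u (star u) := by
  set Q := Matrix.vecMulVec u (star u) with hQ
  have hPQ : P * Q = Q := by rw [hQ, Matrix.mul_vecMulVec, hPu]
  have hQH : Qᴴ = Q := by rw [hQ, Matrix.conjTranspose_vecMulVec, star_star]
  have hQP : Q * P = Q := by
    have := congrArg Matrix.conjTranspose hPQ
    rwa [Matrix.conjTranspose_mul, hH, hQH] at this
  have hQQ : Q * Q = Q := by
    rw [hQ, Matrix.vecMulVec_mul_vecMulVec, hu, one_smul]
  have hE : (P - Q)ᴴ * (P - Q) = P - Q := by
    rw [Matrix.conjTranspose_sub, hH, hQH, sub_mul, mul_sub, mul_sub, hP, hPQ, hQP, hQQ]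
    abel
  have htrE : ((P - Q)ᴴ * (P - Q)).trace = 0 := by
    rw [hE, Matrix.trace_sub, htr, hQ, Matrix.trace_vecMulVec, dotProduct_comm, hu, sub_self]
  exact sub_eq_zero.1 (Matrix.trace_conjTranspose_mul_self_eq_zero_iff.1 htrE)

/-- Two unitary representations of `ZMod d` on `ℂ^d` with `tr (V x W y) = 0` for
`(x, y) ≠ (0, 0)` are measured in mutually unbiased bases. -/
lemma IsUnitaryRep.mutuallyUnbiased_measurement (hV : IsUnitaryRep V) (hW : IsUnitaryRep W)
    (htr : ∀ x y, x ≠ 0 ∨ y ≠ 0 → (V x * W y).trace = 0) (hι : Fintype.card ι = d) :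
    hV.measurement.MutuallyUnbiased hW.measurement := by
  intro a b u v hu hv hau hbv
  have hd : (d : ℂ) ≠ 0 := NeZero.ne _
  have htrV : ∀ x, x ≠ 0 → (V x).trace = 0 := fun x hx => by
    simpa [hW.map_zero] using htr x 0 (Or.inl hx)
  have htrW : ∀ x, x ≠ 0 → (W x).trace = 0 := fun x hx => by
    simpa [hV.map_zero] using htr 0 x (Or.inr hx)
  set α : ZMod d := ((a : ℕ) : ZMod d)
  set β : ZMod d := ((b : ℕ) : ZMod d)
  have hP := eq_vecMulVec_of_trace_eq_one (by simpa using isotypicProj_mul hV α α)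
    (conjTranspose_isotypicProj hV α) (trace_isotypicProj hV htrV hι α) hu hau
  have hQ := eq_vecMulVec_of_trace_eq_one (by simpa using isotypicProj_mul hW β β)
    (conjTranspose_isotypicProj hW β) (trace_isotypicProj hW htrW hι β) hv hbv
  have h1 : (isotypicProj V α * isotypicProj W β).trace = 1 / d := by
    rw [isotypicProj, isotypicProj, smul_mul_smul_comm, Finset.sum_mul_sum, Matrix.trace_smul,
      Matrix.trace_sum, Finset.sum_eq_single_of_mem 0 (Finset.mem_univ _), Matrix.trace_sum,
      Finset.sum_eq_single_of_mem 0 (Finset.mem_univ _)]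
    · simp [hV.map_zero, hW.map_zero, hι, hd]
    · intro y _ hy
      rw [smul_mul_smul_comm, Matrix.trace_smul, htr _ _ (Or.inr hy), smul_zero]
    · intro x _ hx
      rw [Matrix.trace_sum]
      refine Finset.sum_eq_zero fun y _ => ?_
      rw [smul_mul_smul_comm, Matrix.trace_smul, htr _ _ (Or.inl hx), smul_zero]
  have h2 : (isotypicProj V α * isotypicProj W β).trace = ((‖star u ⬝ᵥ v‖ ^ 2 : ℝ) : ℂ) := by
    rw [hP, hQ, Matrix.vecMulVec_mul_vecMulVec, Matrix.trace_vecMulVec, dotProduct_smul,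
      smul_eq_mul, Complex.ofReal_pow, ← Complex.mul_conj', ← Complex.star_def,
      ← Matrix.star_dotProduct, dotProduct_comm u]
  rw [h1] at h2
  apply Complex.ofReal_injective
  rw [← h2, hι]
  push_cast
  rfl

/-- A unitary matrix with `U ^ d = 1` generates a unitary representation of `ZMod d`. -/
lemma isUnitaryRep_pow {U : Matrix ι ι ℂ} (hU : Uᴴ * U = 1) (hd : U ^ d = 1) :
    IsUnitaryRep fun x : ZMod d => U ^ x.val := by
  have hmod : ∀ n : ℕ, U ^ (n % d) = U ^ n := fun n => (pow_eq_pow_mod n hd).symm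
  have hadd : ∀ x y : ZMod d, U ^ (x + y).val = U ^ x.val * U ^ y.val := fun x y => by
    rw [ZMod.val_add, hmod, pow_add]
  have hUn : ∀ n : ℕ, (U ^ n)ᴴ * U ^ n = 1 := by
    intro n
    induction n with
    | zero => simp
    | succ n ih =>
      rw [pow_succ, Matrix.conjTranspose_mul, mul_assoc, ← mul_assoc _ (U ^ n), ih, one_mul, hU]
  refine ⟨by simp, hadd, fun x => ?_⟩
  calc (U ^ x.val)ᴴ = (U ^ x.val)ᴴ * (U ^ x.val * U ^ (-x).val) := by
        rw [← hadd, add_neg_cancel, ZMod.val_zero, pow_zero, mul_one]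
    _ = U ^ (-x).val := by rw [← mul_assoc, hUn, one_mul]

end Spectral

/-! ### Weighted shifts -/

/-- The weighted shift `∑_c f(c) |c + s⟩⟨c|` on `ℂ^d`, with indices modulo `d`. -/
def weightedShift (s : ZMod d) (f : ZMod d → ℂ) : Matrix (Fin d) (Fin d) ℂ :=
  Matrix.of fun r c =>
    if ((r : ℕ) : ZMod d) = ((c : ℕ) : ZMod d) + s then f ((c : ℕ) : ZMod d) else 0

lemma weightedShift_mul [NeZero d] (s t : ZMod d) (f g : ZMod d → ℂ) :
    weightedShift s f * weightedShift t g = weightedShift (s + t) fun c => f (c + t) * g c := by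
  ext r c
  simp only [weightedShift, Matrix.mul_apply, Matrix.of_apply]
  rw [sum_fin_natCast fun k : ZMod d => (if ((r : ℕ) : ZMod d) = k + s then f k else 0) *
      (if k = ((c : ℕ) : ZMod d) + t then g ((c : ℕ) : ZMod d) else 0),
    Finset.sum_eq_single_of_mem (((c : ℕ) : ZMod d) + t) (Finset.mem_univ _)
      fun k _ hk => by rw [if_neg hk, mul_zero], if_pos rfl, ite_mul, zero_mul, add_assoc,
    add_comm t s]

lemma weightedShift_zero_one [NeZero d] : weightedShift (0 : ZMod d) (fun _ => 1) = 1 := by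
  ext r c
  simp only [weightedShift, Matrix.of_apply, add_zero, natCast_fin_inj, Matrix.one_apply]

lemma conjTranspose_weightedShift (s : ZMod d) (f : ZMod d → ℂ) :
    (weightedShift s f)ᴴ = weightedShift (-s) fun c => star (f (c - s)) := by
  ext r c
  simp only [weightedShift, Matrix.conjTranspose_apply, Matrix.of_apply]
  by_cases h : ((c : ℕ) : ZMod d) = ((r : ℕ) : ZMod d) + s
  · rw [if_pos h, if_pos (by rw [h]; ring), h, add_sub_cancel_right]
  · rw [if_neg h, if_neg fun h' => h (by rw [h']; ring), star_zero]

lemma conjTranspose_weightedShift_mul_self [NeZero d] (s : ZMod d)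
    {f : ZMod d → ℂ} (hf : ∀ c, ‖f c‖ = 1) :
    (weightedShift s f)ᴴ * weightedShift s f = 1 := by
  rw [conjTranspose_weightedShift, weightedShift_mul, neg_add_cancel, ← weightedShift_zero_one]
  congr 1
  ext c
  rw [add_sub_cancel_right, Complex.star_def, Complex.conj_mul', hf]
  simp

lemma trace_weightedShift [NeZero d] (s : ZMod d) (f : ZMod d → ℂ) :
    (weightedShift s f).trace = if s = 0 then ∑ c, f c else 0 := by
  simp only [weightedShift, Matrix.trace, Matrix.diag_apply, Matrix.of_apply, left_eq_add]
  split_ifs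
  · exact sum_fin_natCast f
  · simp

lemma trace_weightedShift_mul_neg [NeZero d] (s : ZMod d) (f g : ZMod d → ℂ) :
    (weightedShift s f * weightedShift (-s) g).trace = ∑ c, f (c - s) * g c := by
  rw [weightedShift_mul, trace_weightedShift, add_neg_cancel, if_pos rfl]
  simp only [sub_eq_add_neg]

lemma trace_weightedShift_mul_of_ne [NeZero d] {s t : ZMod d} (h : s + t ≠ 0) (f g : ZMod d → ℂ) :
    (weightedShift s f * weightedShift t g).trace = 0 := by
  rw [weightedShift_mul, trace_weightedShift, if_neg h]

lemma smul_weightedShift (z : ℂ) (s : ZMod d) (f : ZMod d → ℂ) :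
    z • weightedShift s f = weightedShift s fun c => z * f c := by
  ext r c
  simp [weightedShift]

lemma sum_weightedShift {α : Type*} (t : Finset α) (s : ZMod d) (f : α → ZMod d → ℂ) :
    ∑ i ∈ t, weightedShift s (f i) = weightedShift s fun c => ∑ i ∈ t, f i c := by
  ext r c
  simp only [weightedShift, Matrix.sum_apply, Matrix.of_apply]
  split_ifs <;> simp

lemma weightedShift_map_star (s : ZMod d) (f : ZMod d → ℂ) :
    (weightedShift s f).map star = weightedShift s fun c => star (f c) := by
  ext r c
  simp only [weightedShift, Matrix.map_apply, Matrix.of_apply]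
  split_ifs <;> simp

/-! ### The observables of the optimal realisation -/

/-- The phases of `B_k^n` as a weighted shift by `n`. -/
noncomputable def bobWeight (k n : ZMod d) [Fact d.Prime] (c : ZMod d) : ℂ :=
  ψ (n * (k * (k + 1)) + n * k * c + k * (n * (n - 1)) / 2)

lemma shiftX_mul_clockZ_pow [Fact d.Prime] (k : ℕ) :
    shiftX d * clockZ d ^ k = weightedShift 1 fun c : ZMod d => (ψ ((k : ZMod d) * c) : ℂ) := by
  ext r c
  rw [clockZ, Matrix.diagonal_pow, Matrix.mul_diagonal]
  simp only [shiftX, weightedShift, Matrix.of_apply, Pi.pow_apply, omega_pow,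
    stdAddChar_natCast_pow]
  have hiff : (r : ℕ) = ((c : ℕ) + 1) % d ↔
      ((r : ℕ) : ZMod d) = ((c : ℕ) : ZMod d) + 1 := by
    rw [← Nat.cast_add_one, ZMod.natCast_eq_natCast_iff', Nat.mod_eq_of_lt r.2]
  simp only [hiff, ite_mul, one_mul, zero_mul]

lemma bobObs_pow [Fact d.Prime] (hd : d ≠ 2) (k : Fin d) (n : ℕ) :
    bobObs d k ^ n = weightedShift (n : ZMod d) (bobWeight ((k : ℕ) : ZMod d) n) := by
  have h2 := ne_zero_two hd
  have h1 : bobObs d k = weightedShift 1 (bobWeight ((k : ℕ) : ZMod d) 1) := by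
    rw [bobObs, shiftX_mul_clockZ_pow, smul_weightedShift]
    congr 1
    ext c
    rw [omega_pow, ← AddChar.map_add_eq_mul, bobWeight]
    congr 1
    push_cast
    ring
  induction n with
  | zero =>
    rw [pow_zero, Nat.cast_zero, ← weightedShift_zero_one]
    congr 1
    ext c
    simp [bobWeight]
  | succ n ih =>
    rw [pow_succ, ih, h1, weightedShift_mul, Nat.cast_succ]
    congr 1
    ext c
    simp only [bobWeight]
    rw [← AddChar.map_add_eq_mul]
    congr 1
    field_simp
    ring

/-- The phases of `C_j^{(n)}` as a weighted shift by `n`, obtained by completing the square. -/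
noncomputable def dualWeight [Fact d.Prime] (j : ZMod d) (n : ℕ) (c : ZMod d) : ℂ :=
  cubicPhase d n * ψ (-((n : ZMod d) * (j + c + ((n : ZMod d) + 1) / 2) ^ 2 / 4))

lemma norm_stdAddChar [NeZero d] (x : ZMod d) : ‖(ψ x : ℂ)‖ = 1 := by
  exact AddChar.norm_apply _ _

lemma norm_dualWeight [Fact d.Prime] (j : ZMod d) (n : ℕ) (c : ZMod d) :
    ‖dualWeight j n c‖ = 1 := by
  rw [dualWeight, norm_mul, norm_cubicPhase, norm_stdAddChar, one_mul]

/-- The Gauss sum evaluation turns `C_j^{(n)}` into a unitary weighted shift. -/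
lemma opC_phase_eq_weightedShift [Fact d.Prime] (hd : d ≠ 2) (j : Fin d) {n : ℕ} (h1 : 1 ≤ n)
    (hn : n < d) :
    opC d (phase d) j n = weightedShift (n : ZMod d) (dualWeight ((j : ℕ) : ZMod d) n) := by
  have h2 := ne_zero_two hd
  have hs : ((√(d : ℝ) : ℝ) : ℂ) ≠ 0 := sqrt_natCast_ne_zero
  have hn0 : (n : ZMod d) ≠ 0 := by
    rw [Ne, ZMod.natCast_eq_zero_iff]
    exact fun h => absurd (Nat.le_of_dvd (by lia) h) (by lia)
  have hne : legendreChar d n * epsilon d ≠ 0 := by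
    intro h
    have := (admissiblePhases_phase hd).1 n hn
    rw [phase_eq hd (by lia), h] at this
    simp at this
  simp only [opC, bobObs_pow hd, smul_weightedShift, sum_weightedShift]
  congr 1
  ext c
  rw [dualWeight]
  set s : ZMod d := ((j : ℕ) : ZMod d) + c + ((n : ZMod d) + 1) / 2 with hsdef
  -- Substituting `x = k + s / 2` completes the square.
  have hsum : ∑ k : Fin d, omega d ^ (n * (j : ℕ) * (k : ℕ)) * bobWeight ((k : ℕ) : ZMod d) n c =
      ψ (-((n : ZMod d) * s ^ 2 / 4)) * ∑ x : ZMod d, (ψ ((n : ZMod d) * x ^ 2) : ℂ) := by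
    have h4 : (4 : ZMod d) ≠ 0 := by
      rw [show (4 : ZMod d) = 2 ^ 2 by norm_num]; exact pow_ne_zero _ h2
    rw [Finset.mul_sum, ← Equiv.sum_comp (Equiv.addRight (s / 2)),
      ← sum_fin_natCast]
    refine Finset.sum_congr rfl fun k _ => ?_
    rw [omega_pow, bobWeight, ← AddChar.map_add_eq_mul, ← AddChar.map_add_eq_mul]
    congr 1
    rw [Equiv.coe_addRight, hsdef]
    push_cast
    field_simp
    ring
  obtain ⟨hL, hE⟩ := mul_ne_zero_iff.1 hne
  rw [hsum, sum_stdAddChar_mul_sq hd hn0, phase_eq hd (by lia)]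
  field_simp

/-- The recursion of the cubic phases makes `C_j^{(n)}` the `n`-th power of `C_j^{(1)}`. -/
lemma opC_one_pow [Fact d.Prime] (hd : d ≠ 2) (j : Fin d) (n : ℕ) :
    opC d (phase d) j 1 ^ n = weightedShift (n : ZMod d) (dualWeight ((j : ℕ) : ZMod d) n) := by
  have h2 := ne_zero_two hd
  have h4 : (4 : ZMod d) ≠ 0 := by
    rw [show (4 : ZMod d) = 2 ^ 2 by norm_num]; exact pow_ne_zero _ h2
  have h16 : (16 : ZMod d) ≠ 0 := by
    rw [show (16 : ZMod d) = 2 ^ 4 by norm_num]; exact pow_ne_zero _ h2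
  induction n with
  | zero =>
    rw [pow_zero, Nat.cast_zero, ← weightedShift_zero_one]
    congr 1
    ext c
    simp [dualWeight, cubicPhase_zero]
  | succ n ih =>
    rw [pow_succ', ih, opC_phase_eq_weightedShift hd j le_rfl (Fact.out : d.Prime).one_lt,
      weightedShift_mul, Nat.cast_one, add_comm, ← Nat.cast_succ]
    congr 1
    ext c
    simp only [dualWeight]
    rw [cubicPhase_succ hd n, mul_mul_mul_comm, mul_assoc (_ * _),
      ← AddChar.map_add_eq_mul, ← AddChar.map_add_eq_mul]
    congr 2
    push_cast
    field_simp
    ring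

/-- Alice's powers are weighted shifts with conjugate phases. -/
lemma aliceObs_pow [Fact d.Prime] (hd : d ≠ 2) (j : Fin d) (n : ℕ) :
    aliceObs d (phase d) j ^ n =
      weightedShift (n : ZMod d) fun c => star (dualWeight ((j : ℕ) : ZMod d) n c) := by
  rw [aliceObs, ← weightedShift_map_star, ← opC_one_pow hd]
  exact (Matrix.map_pow _ (starRingEnd ℂ) n).symm

lemma bobObs_pow_self [Fact d.Prime] (hd : d ≠ 2) (k : Fin d) : bobObs d k ^ d = 1 := by
  rw [bobObs_pow hd, ← weightedShift_zero_one, CharP.cast_eq_zero]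
  congr 1
  ext c
  simp [bobWeight]

lemma aliceObs_pow_self [Fact d.Prime] (hd : d ≠ 2) (j : Fin d) :
    aliceObs d (phase d) j ^ d = 1 := by
  have hodd : d % 2 = 1 := Nat.Prime.eq_two_or_odd Fact.out |>.resolve_left hd
  rw [aliceObs_pow hd, ← weightedShift_zero_one, CharP.cast_eq_zero]
  congr 1
  ext c
  simp [dualWeight, cubicPhase_self hodd]

lemma conjTranspose_bobObs_mul_self [Fact d.Prime] (hd : d ≠ 2) (k : Fin d) :
    (bobObs d k)ᴴ * bobObs d k = 1 := by
  rw [← pow_one (bobObs d k), bobObs_pow hd]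
  exact conjTranspose_weightedShift_mul_self _ fun c => norm_stdAddChar _

lemma conjTranspose_aliceObs_mul_self [Fact d.Prime] (hd : d ≠ 2) (j : Fin d) :
    (aliceObs d (phase d) j)ᴴ * aliceObs d (phase d) j = 1 := by
  rw [← pow_one (aliceObs d (phase d) j), aliceObs_pow hd]
  exact conjTranspose_weightedShift_mul_self _ fun c => by rw [norm_star, norm_dualWeight]

lemma sum_stdAddChar_affine [NeZero d] {a : ZMod d} (ha : a ≠ 0) (b : ZMod d) :
    ∑ x : ZMod d, (ψ (a * x + b) : ℂ) = 0 := by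
  simp only [AddChar.map_add_eq_mul, ← Finset.sum_mul, sum_stdAddChar_mul, if_neg ha, zero_mul]

lemma trace_bobObs_pow [Fact d.Prime] (hd : d ≠ 2) (k : Fin d) {x : ZMod d} (hx : x ≠ 0) :
    (bobObs d k ^ x.val).trace = 0 := by
  rw [bobObs_pow hd, ZMod.natCast_zmod_val, trace_weightedShift, if_neg hx]

lemma trace_aliceObs_pow [Fact d.Prime] (hd : d ≠ 2) (j : Fin d) {x : ZMod d} (hx : x ≠ 0) :
    (aliceObs d (phase d) j ^ x.val).trace = 0 := by
  rw [aliceObs_pow hd, ZMod.natCast_zmod_val, trace_weightedShift, if_neg hx]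

lemma trace_bobObs_pow_mul [Fact d.Prime] (hd : d ≠ 2) {k k' : Fin d} (hk : k ≠ k')
    {x y : ZMod d} (hxy : x ≠ 0 ∨ y ≠ 0) :
    (bobObs d k ^ x.val * bobObs d k' ^ y.val).trace = 0 := by
  rw [bobObs_pow hd, bobObs_pow hd, ZMod.natCast_zmod_val, ZMod.natCast_zmod_val]
  by_cases h : x + y = 0
  · obtain rfl : y = -x := by linear_combination h
    have hx : x ≠ 0 := by simpa using hxy
    have hkk : ((k : ℕ) : ZMod d) - ((k' : ℕ) : ZMod d) ≠ 0 := by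
      rw [Ne, sub_eq_zero, natCast_fin_inj]; exact hk
    rw [trace_weightedShift_mul_neg,
      ← sum_stdAddChar_affine (mul_ne_zero hx hkk)
        (x * (((k : ℕ) : ZMod d) * (((k : ℕ) : ZMod d) + 1)) - x * ((k : ℕ) : ZMod d) * x +
          ((k : ℕ) : ZMod d) * (x * (x - 1)) / 2 -
          x * (((k' : ℕ) : ZMod d) * (((k' : ℕ) : ZMod d) + 1)) +
          ((k' : ℕ) : ZMod d) * (-x * (-x - 1)) / 2)]
    refine Finset.sum_congr rfl fun c _ => ?_
    rw [bobWeight, bobWeight, ← AddChar.map_add_eq_mul]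
    congr 1
    ring
  · exact trace_weightedShift_mul_of_ne h _ _

lemma trace_aliceObs_pow_mul [Fact d.Prime] (hd : d ≠ 2) {j j' : Fin d} (hj : j ≠ j')
    {x y : ZMod d} (hxy : x ≠ 0 ∨ y ≠ 0) :
    (aliceObs d (phase d) j ^ x.val * aliceObs d (phase d) j' ^ y.val).trace = 0 := by
  have h2 := ne_zero_two hd
  have h4 : (4 : ZMod d) ≠ 0 := by
    rw [show (4 : ZMod d) = 2 ^ 2 by norm_num]; exact pow_ne_zero _ h2
  rw [aliceObs_pow hd, aliceObs_pow hd, ZMod.natCast_zmod_val, ZMod.natCast_zmod_val]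
  by_cases h : x + y = 0
  · obtain rfl : y = -x := by linear_combination h
    have hx : x ≠ 0 := by simpa using hxy
    have hjj : ((j : ℕ) : ZMod d) - ((j' : ℕ) : ZMod d) ≠ 0 := by
      rw [Ne, sub_eq_zero, natCast_fin_inj]; exact hj
    rw [trace_weightedShift_mul_neg]
    simp only [← star_mul', ← star_sum]
    rw [star_eq_zero]
    -- the squares of the two exponents cancel and leave an affine function of `c`
    have e : ∀ c : ZMod d, dualWeight ((j : ℕ) : ZMod d) x.val (c - x) *
        dualWeight ((j' : ℕ) : ZMod d) (-x).val c =
        cubicPhase d x.val * cubicPhase d (-x).val *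
          ψ (-(x * (((j : ℕ) : ZMod d) - ((j' : ℕ) : ZMod d)) / 2) * c +
            -(x / 4 * (((j : ℕ) : ZMod d) - ((j' : ℕ) : ZMod d)) *
              (((j : ℕ) : ZMod d) + ((j' : ℕ) : ZMod d) + 1 - x))) := by
      intro c
      rw [dualWeight, dualWeight, mul_mul_mul_comm, ← AddChar.map_add_eq_mul,
        ZMod.natCast_zmod_val, ZMod.natCast_zmod_val]
      congr 2
      field_simp
      ring
    simp only [e, ← Finset.mul_sum]
    rw [sum_stdAddChar_affine (neg_ne_zero.2 (div_ne_zero (mul_ne_zero hx hjj) h2)), mul_zero]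
  · exact trace_weightedShift_mul_of_ne h _ _

/-- The representation `x ↦ A_j^x` generated by Alice's observable. -/
lemma isUnitaryRep_aliceObs [Fact d.Prime] (hd : d ≠ 2) (j : Fin d) :
    IsUnitaryRep fun x : ZMod d => aliceObs d (phase d) j ^ x.val :=
  isUnitaryRep_pow (conjTranspose_aliceObs_mul_self hd j) (aliceObs_pow_self hd j)

/-- The representation `x ↦ B_k^x` generated by Bob's observable. -/
lemma isUnitaryRep_bobObs [Fact d.Prime] (hd : d ≠ 2) (k : Fin d) :
    IsUnitaryRep fun x : ZMod d => bobObs d k ^ x.val :=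
  isUnitaryRep_pow (conjTranspose_bobObs_mul_self hd k) (bobObs_pow_self hd k)

lemma pow_val_natCast [NeZero d] {U : Matrix (Fin d) (Fin d) ℂ} (hU : U ^ d = 1) (n : ℕ) :
    U ^ (n : ZMod d).val = U ^ n := by
  rw [ZMod.val_natCast, ← pow_eq_pow_mod n hU]

/-! ### The value of the optimal realisation -/

lemma star_maxEntangled_dotProduct [NeZero d] (v : Fin d × Fin d → ℂ) :
    star (maxEntangled d) ⬝ᵥ v = (1 / ((√(d : ℝ) : ℝ) : ℂ)) * ∑ i : Fin d, v (i, i) := by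
  simp only [dotProduct, Fintype.sum_prod_type, Pi.star_apply, maxEntangled, apply_ite star,
    star_zero, ite_mul, zero_mul, Finset.sum_ite_eq, Finset.mem_univ, if_true, Finset.mul_sum]
  simp

lemma star_maxEntangled_dotProduct_self [NeZero d] :
    star (maxEntangled d) ⬝ᵥ maxEntangled d = 1 := by
  have hd : (d : ℂ) ≠ 0 := NeZero.ne _
  rw [star_maxEntangled_dotProduct]
  simp only [maxEntangled, if_true, Finset.sum_const, Finset.card_univ, Fintype.card_fin,
    nsmul_eq_mul, Complex.ofReal_div, Complex.ofReal_one]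
  rw [mul_left_comm, div_mul_div_comm, sqrt_natCast_mul_self]
  field_simp

/-- The expectation of `conj U ⊗ U` in the maximally entangled state is `1` for unitary `U`. -/
lemma maxEntangled_expectation_map_star [NeZero d] {U : Matrix (Fin d) (Fin d) ℂ}
    (hU : Uᴴ * U = 1) :
    star (maxEntangled d) ⬝ᵥ (U.map star ⊗ₖ U) *ᵥ maxEntangled d = 1 := by
  have hd : (d : ℂ) ≠ 0 := NeZero.ne _
  have htr : (Uᴴ * U).trace = d := by rw [hU]; simp
  have e : ∀ i, ((U.map star ⊗ₖ U) *ᵥ maxEntangled d) (i, i) =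
      1 / ((√(d : ℝ) : ℝ) : ℂ) * ∑ c, star (U i c) * U i c := by
    intro i
    simp only [Matrix.mulVec, dotProduct, Fintype.sum_prod_type, maxEntangled, mul_ite, mul_zero,
      Finset.sum_ite_eq, Finset.mem_univ, if_true, Finset.mul_sum, Matrix.kroneckerMap_apply,
      Matrix.map_apply]
    refine Finset.sum_congr rfl fun c _ => ?_
    push_cast
    ring
  rw [star_maxEntangled_dotProduct]
  simp only [e, ← Finset.mul_sum]
  rw [← mul_assoc, div_mul_div_comm, sqrt_natCast_mul_self, Finset.sum_comm]
  have : ∑ c, ∑ i, star (U i c) * U i c = (Uᴴ * U).trace := by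
    simp [Matrix.trace, Matrix.mul_apply, Matrix.diag]
  rw [this, htr]
  field_simp

/-- Any measurements with the transforms `A_j^n` and `B_k^n` reach the bound in the maximally
entangled state. -/
lemma maxEntangled_expectation_bellOperator [Fact d.Prime] (hd : d ≠ 2)
    {MA MB : Fin d → Measurement d (Fin d)}
    (hA : ∀ j n, (MA j).fourier n = aliceObs d (phase d) j ^ n)
    (hB : ∀ k n, (MB k).fourier n = bobObs d k ^ n) :
    star (maxEntangled d) ⬝ᵥ bellOperator d (phase d) MA MB *ᵥ maxEntangled d =
      ((optimalValue d : ℝ) : ℂ) := by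
  have hd0 : (d : ℂ) ≠ 0 := NeZero.ne _
  have hs : ((√(d : ℝ) : ℝ) : ℂ) ≠ 0 := sqrt_natCast_ne_zero
  have hterm : ∀ n ∈ Finset.Ico 1 d, ∀ j,
      star (maxEntangled d) ⬝ᵥ
        ((MA j).fourier n ⊗ₖ dualOp (phase d) MB j n) *ᵥ maxEntangled d = 1 := by
    intro n hn j
    have hn := Finset.mem_Ico.1 hn
    have h1 : dualOp (phase d) MB j n =
        weightedShift (n : ZMod d) (dualWeight ((j : ℕ) : ZMod d) n) := by
      rw [← opC_phase_eq_weightedShift hd j hn.1 hn.2, dualOp, opC]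
      simp only [hB]
    rw [h1, hA, aliceObs_pow hd, ← weightedShift_map_star]
    exact maxEntangled_expectation_map_star
      (conjTranspose_weightedShift_mul_self _ (norm_dualWeight _ _))
  rw [bellOperator_eq_dualOp (admissiblePhases_phase hd).2.1, Matrix.add_mulVec, dotProduct_add,
    Matrix.smul_mulVec, Matrix.smul_mulVec, Matrix.one_mulVec, dotProduct_smul, dotProduct_smul,
    star_maxEntangled_dotProduct_self, Matrix.sum_mulVec, dotProduct_sum]
  simp only [Matrix.sum_mulVec, dotProduct_sum]
  rw [Finset.sum_congr rfl fun n hn => Finset.sum_congr rfl fun j _ => hterm n hn j]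
  simp only [Finset.sum_const, Finset.card_univ, Fintype.card_fin, Nat.card_Ico, nsmul_eq_mul,
    smul_eq_mul, mul_one]
  rw [Nat.cast_sub (Fact.out : d.Prime).one_le, optimalValue]
  push_cast
  rw [← sub_eq_zero]
  field_simp
  linear_combination ((d : ℂ) - 1) * sqrt_natCast_mul_self d

/-! ### The quantum value -/

lemma trace_mul_nonneg {η : Type*} [Fintype η] {K ρ : Matrix η η ℂ} (hK : K.PosSemidef)
    (hρ : ρ.PosSemidef) : 0 ≤ (K * ρ).trace := by
  obtain ⟨m, v, rfl⟩ := Matrix.posSemidef_iff_eq_sum_vecMulVec.1 hρ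
  rw [Finset.mul_sum, Matrix.trace_sum]
  refine Finset.sum_nonneg fun i _ => ?_
  rw [Matrix.mul_vecMulVec, Matrix.trace_vecMulVec, dotProduct_comm]
  exact hK.dotProduct_mulVec_nonneg _

/-- The Bell functional of a quantum correlation is the expectation of the Bell operator. -/
lemma bellFunctional_eq_trace [NeZero d] {lam : ℕ → ℂ} (hlam : AdmissiblePhases d lam)
    {ι κ : Type*} [Fintype ι] [DecidableEq ι] [Fintype κ] [DecidableEq κ]
    {MA : Fin d → Measurement d ι} {MB : Fin d → Measurement d κ} {ρ : Matrix (ι × κ) (ι × κ) ℂ}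
    {P : Fin d → Fin d → Fin d → Fin d → ℝ}
    (hP : ∀ a b j k, (P a b j k : ℂ) = (((MA j).F a ⊗ₖ (MB k).F b) * ρ).trace) :
    ((bellFunctional d lam P : ℝ) : ℂ) = (bellOperator d lam MA MB * ρ).trace := by
  have hre : ∀ a b j k, (((bellCoeff d lam a b j k).re : ℝ) : ℂ) = bellCoeff d lam a b j k :=
    fun a b j k => Complex.conj_eq_iff_re.1 (star_bellCoeff hlam a b j k)
  simp only [bellOperator_eq_sum, bellFunctional, Complex.ofReal_sum, Complex.ofReal_mul, hre, hP,
    Finset.sum_mul, Matrix.trace_sum, smul_mul_assoc, Matrix.trace_smul, smul_eq_mul]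

lemma bellFunctional_le [Fact d.Prime] {lam : ℕ → ℂ} (hlam : AdmissiblePhases d lam)
    {P : Fin d → Fin d → Fin d → Fin d → ℝ} (hP : P ∈ quantumSet d) :
    bellFunctional d lam P ≤ optimalValue d := by
  obtain ⟨m, n, ρ, MA, MB, ⟨hρ, htr⟩, hP⟩ := hP
  have h := trace_mul_nonneg (Matrix.le_iff.1 (bellOperator_le hlam MA MB)) hρ
  rw [sub_mul, Matrix.trace_sub, smul_mul_assoc, one_mul, Matrix.trace_smul, htr, smul_eq_mul,
    mul_one, ← bellFunctional_eq_trace hlam hP, ← Complex.ofReal_sub, Complex.zero_le_real] at h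
  linarith

/-- An expectation of the Bell operator in a unit vector is a value of the Bell functional. -/
lemma mem_image_bellFunctional [NeZero d] {lam : ℕ → ℂ} (hlam : AdmissiblePhases d lam)
    {m n : ℕ} {MA : Fin d → Measurement d (Fin m)} {MB : Fin d → Measurement d (Fin n)}
    {φ : Fin m × Fin n → ℂ} (hφ : star φ ⬝ᵥ φ = 1) {r : ℝ}
    (hr : star φ ⬝ᵥ bellOperator d lam MA MB *ᵥ φ = (r : ℂ)) :
    r ∈ bellFunctional d lam '' quantumSet d := by
  set ρ := Matrix.vecMulVec φ (star φ) with hρdef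
  have hρ : ρ.PosSemidef := Matrix.posSemidef_vecMulVec_self_star φ
  have hreal : ∀ a b j k, ((((((MA j).F a ⊗ₖ (MB k).F b) * ρ).trace).re : ℝ) : ℂ) =
      (((MA j).F a ⊗ₖ (MB k).F b) * ρ).trace := by
    intro a b j k
    have h := trace_mul_nonneg (((MA j).posSemidef a).kronecker ((MB k).posSemidef b)) hρ
    exact Complex.ext (by simp) (by simpa using (Complex.nonneg_iff.1 h).2)
  refine ⟨fun a b j k => (((MA j).F a ⊗ₖ (MB k).F b) * ρ).trace.re,
    ⟨m, n, ρ, MA, MB, ⟨hρ, ?_⟩, hreal⟩, ?_⟩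
  · rw [hρdef, Matrix.trace_vecMulVec, dotProduct_comm, hφ]
  · apply Complex.ofReal_injective
    rw [bellFunctional_eq_trace hlam hreal, ← hr, hρdef, Matrix.mul_vecMulVec,
      Matrix.trace_vecMulVec, dotProduct_comm]

end BuhrmanMassar

theorem mainTheorem1 (d : ℕ) [Fact d.Prime] :
    -- the upper bound, for arbitrary admissible phases
    (∀ lam : ℕ → ℂ, AdmissiblePhases d lam →
      (∀ a b j k : Fin d, (bellCoeff d lam a b j k).im = 0) ∧
      ∀ (ι κ : Type*) [Fintype ι] [DecidableEq ι] [Fintype κ] [DecidableEq κ]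
        (MA : Fin d → Measurement d ι) (MB : Fin d → Measurement d κ),
        bellOperator d lam MA MB =
            ∑ a : Fin d, ∑ b : Fin d, ∑ j : Fin d, ∑ k : Fin d,
              bellCoeff d lam a b j k • ((MA j).F a ⊗ₖ (MB k).F b) ∧
          bellOperator d lam MA MB ≤ ((optimalValue d : ℝ) : ℂ) • (1 : Matrix (ι × κ) (ι × κ) ℂ)) ∧
    -- attainment and the quantum value, for odd primes and the explicit phases
    (d ≠ 2 →
      AdmissiblePhases d (phase d) ∧
      (∃ MA MB : Fin d → Measurement d (Fin d),
        (∀ j, (MA j).IsRankOneProjective) ∧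
        (∀ k, (MB k).IsRankOneProjective) ∧
        (∀ j n, (MA j).fourier n = aliceObs d (phase d) j ^ n) ∧
        (∀ k n, (MB k).fourier n = bobObs d k ^ n) ∧
        (∀ j j', j ≠ j' → (MA j).MutuallyUnbiased (MA j')) ∧
        (∀ k k', k ≠ k' → (MB k).MutuallyUnbiased (MB k')) ∧
        star (maxEntangled d) ⬝ᵥ maxEntangled d = 1 ∧
        star (maxEntangled d) ⬝ᵥ Matrix.mulVec (bellOperator d (phase d) MA MB) (maxEntangled d)
          = ((optimalValue d : ℝ) : ℂ)) ∧
      IsGreatest (bellFunctional d (phase d) '' quantumSet d) (optimalValue d) ∧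
      quantumValue d (phase d) = optimalValue d) := by
  refine ⟨fun lam hlam => ⟨fun a b j k => ?_, fun ι κ _ _ _ _ MA MB =>
    ⟨bellOperator_eq_sum lam MA MB, bellOperator_le hlam MA MB⟩⟩, fun hd => ?_⟩
  · exact Complex.conj_eq_iff_im.1 (star_bellCoeff hlam a b j k)
  · have hadm := admissiblePhases_phase hd
    set MA : Fin d → Measurement d (Fin d) := fun j => (isUnitaryRep_aliceObs hd j).measurement
    set MB : Fin d → Measurement d (Fin d) := fun k => (isUnitaryRep_bobObs hd k).measurement
    have hA : ∀ j n, (MA j).fourier n = aliceObs d (phase d) j ^ n := fun j n =>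
      ((isUnitaryRep_aliceObs hd j).fourier_measurement n).trans
        (pow_val_natCast (aliceObs_pow_self hd j) n)
    have hB : ∀ k n, (MB k).fourier n = bobObs d k ^ n := fun k n =>
      ((isUnitaryRep_bobObs hd k).fourier_measurement n).trans
        (pow_val_natCast (bobObs_pow_self hd k) n)
    have hval := maxEntangled_expectation_bellOperator hd hA hB
    have hgreatest : IsGreatest (bellFunctional d (phase d) '' quantumSet d) (optimalValue d) := by
      refine ⟨mem_image_bellFunctional hadm star_maxEntangled_dotProduct_self hval, ?_⟩
      rintro _ ⟨P, hP, rfl⟩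
      exact bellFunctional_le hadm hP
    refine ⟨hadm, ⟨MA, MB, fun j => ?_, fun k => ?_, hA, hB, fun j j' hj => ?_, fun k k' hk => ?_,
      star_maxEntangled_dotProduct_self, hval⟩, hgreatest, hgreatest.csSup_eq⟩
    · exact (isUnitaryRep_aliceObs hd j).isRankOneProjective_measurement
        (fun x hx => trace_aliceObs_pow hd j hx) (Fintype.card_fin d)
    · exact (isUnitaryRep_bobObs hd k).isRankOneProjective_measurement
        (fun x hx => trace_bobObs_pow hd k hx) (Fintype.card_fin d)
    · exact (isUnitaryRep_aliceObs hd j).mutuallyUnbiased_measurement (isUnitaryRep_aliceObs hd j')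
        (fun x y hxy => trace_aliceObs_pow_mul hd hj hxy) (Fintype.card_fin d)
    · exact (isUnitaryRep_bobObs hd k).mutuallyUnbiased_measurement (isUnitaryRep_bobObs hd k')
        (fun x y hxy => trace_bobObs_pow_mul hd hk hxy) (Fintype.card_fin d)
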